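/- For $x \ge 0$ let $W(x)$ be the Lambert $W$ function (principal branch), so $W(x)e^{W(x)} = x$. For $\delta, \epsilon > 0$ put $$k = \frac{1}{\delta}\sqrt{\frac12 W\left(\frac{2^{11}}{\pi\epsilon^8}\right)},\qquad t = \left\lceil \max\left\{\frac{e^2k^2}{2},\ \log\frac{2^8 k}{\sqrt{\pi}\,\epsilon^4}\right\}\right\rceil,\qquad d = 2\left\lceil\sqrt{t\,W\left(\frac{2^{16}k^2}{\pi t\epsilon^8}\right)}\right\rceil + 1 .$$ For an orthogonal projector $P$ on a complex Hilbert space $\mathcal H$, let $C_P\mathrm{NOT} = X \otimes P + I \otimes (I_{\mathcal H} - P)$ on $\mathbb{C}^2 \otimes \mathcal{H}$, where $X$ is the Pauli matrix on the ancilla qubit $\mathbb{C}^2$. **Theorem (fixed-point amplitude amplification).** There is a universal constant $C$ such that for all $\delta, \epsilon > 0$ there is a quantum circuit (a sequence of gates on one ancilla qubit and a system register, depending only on $\delta$ and $\epsilon$) which consists of exactly $d$ applications in total of $U$ and $U^\dagger$, exactly $d+1$ applications of $C_\Pi\mathrm{NOT}$, exactly $d-1$ applications of $C_{|\psi_0\rangle\langle\psi_0|}\mathrm{NOT}$,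 and at most $C d$ other gates, all of them one-qubit gates on the ancilla, and which has the following property. Let $\mathcal{H}$ be a complex Hilbert space, $U$ a unitary and $\Pi$ an orthogonal projector on $\mathcal{H}$, $|\psi_0\rangle, |\psi_G\rangle \in \mathcal{H}$ unit vectors, and $\alpha$ a real number with $\Pi U|\psi_0\rangle = \alpha|\psi_G\rangle$ and $\alpha \ge \delta$. Then the operator $\tilde U$ that the circuit implements on $\mathbb{C}^2 \otimes \mathcal{H}$ satisfies $$\left\| |0\rangle \otimes |\psi_G\rangle - \tilde U\left(|0\rangle \otimes |\psi_0\rangle\right) \right\| \le \epsilon .$$ Moreover $d = O\left(\frac1\delta\log\frac1\epsilon\right)$: for every $\epsilon_0 \in (0,1)$ there is a constant $C'$ such that $d \le C'\,\frac{1}{\delta}\log\frac{1}{\epsilon}$ for all $0 < \delta \le 1$ and $0 < \epsilon \le \epsilon_0$. -/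

import Mathlib

open scoped TensorProduct

noncomputable section

namespace FPAA

/-! ### The explicit number of queries -/

/-- The principal branch of the Lambert W function: on `[-1/e, ∞)` it is the inverse of
`w ↦ w * exp w` on `[-1, ∞)`. -/
def lambertW (x : ℝ) : ℝ :=
  Function.invFunOn (fun w : ℝ => w * Real.exp w) (Set.Ici (-1)) x

theorem lambertW_spec {x : ℝ} (hx : 0 ≤ x) :
    -1 ≤ lambertW x ∧ lambertW x * Real.exp (lambertW x) = x := by
  have hmem : x ∈ Set.Icc ((0 : ℝ) * Real.exp 0) (x * Real.exp x) := by
    refine ⟨by simpa using hx, ?_⟩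
    nlinarith [Real.add_one_le_exp x]
  have hc : ContinuousOn (fun w : ℝ => w * Real.exp w) (Set.Icc 0 x) := by fun_prop
  obtain ⟨w, hw, hwx⟩ := intermediate_value_Icc hx hc hmem
  have h : ∃ a ∈ Set.Ici (-1 : ℝ), (fun w : ℝ => w * Real.exp w) a = x :=
    ⟨w, Set.mem_Ici.2 (by linarith [hw.1]), hwx⟩
  exact ⟨Function.invFunOn_mem h, Function.invFunOn_eq h⟩

/-- `k = (1/δ) √(½ W(2¹¹ / (π ε⁸)))`. -/
def kParam (δ ε : ℝ) : ℝ :=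
  1 / δ * √(1 / 2 * lambertW (2 ^ 11 / (Real.pi * ε ^ 8)))

/-- `t = ⌈max {e² k² / 2, log (2⁸ k / (√π ε⁴))}⌉`. -/
def tParam (δ ε : ℝ) : ℕ :=
  ⌈max (Real.exp 1 ^ 2 * kParam δ ε ^ 2 / 2)
    (Real.log (2 ^ 8 * kParam δ ε / (√Real.pi * ε ^ 4)))⌉₊

/-- `d = 2 ⌈√(t W(2¹⁶ k² / (π t ε⁸)))⌉ + 1`. -/
def numQueries (δ ε : ℝ) : ℕ :=
  2 * ⌈√(tParam δ ε *
    lambertW (2 ^ 16 * kParam δ ε ^ 2 / (Real.pi * tParam δ ε * ε ^ 8)))⌉₊ + 1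

/-! ### Circuits on one ancilla qubit and a system register -/

/-- The state space of the ancilla qubit. -/
abbrev Qubit : Type := EuclideanSpace ℂ (Fin 2)

/-- The ancilla state `|0⟩`. -/
def ket0 : Qubit := EuclideanSpace.single 0 1

/-- The Pauli operator `X`. -/
def pauliX : Qubit →ₗ[ℂ] Qubit := Matrix.toEuclideanLin !![0, 1; 1, 0]

/-- The elementary gates: the two oracle queries `U` and `U†`, the two projector-controlled NOT
gates (with the ancilla as target), and an arbitrary one-qubit gate on the ancilla. -/
inductive Gate : Type
  | query : Gate
  | queryAdj : Gate
  | cnotProj : Gate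
  | cnotInit : Gate
  | ancilla (V : Matrix.unitaryGroup (Fin 2) ℂ) : Gate

/-- A circuit is a list of gates; the head of the list is applied first. -/
abbrev Circuit : Type := List Gate

namespace Gate

/-- The gate is a use of `U` or of `U†`. -/
def isQuery : Gate → Bool
  | query => true
  | queryAdj => true
  | _ => false

/-- The gate is a use of `C_Π NOT`. -/
def isCnotProj : Gate → Bool
  | cnotProj => true
  | _ => false

/-- The gate is a use of `C_{|ψ₀⟩⟨ψ₀|} NOT`. -/
def isCnotInit : Gate → Bool
  | cnotInit => true
  | _ => false

/-- The gate is a one-qubit gate on the ancilla. -/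
def isAncilla : Gate → Bool
  | ancilla _ => true
  | _ => false

end Gate

section Semantics

variable {H : Type*} [NormedAddCommGroup H] [InnerProductSpace ℂ H]

/-- The `P`-controlled NOT gate `X ⊗ P + I ⊗ (I - P)`. -/
def cnot (P : H →L[ℂ] H) : Qubit ⊗[ℂ] H →ₗ[ℂ] Qubit ⊗[ℂ] H :=
  TensorProduct.map pauliX (P : H →ₗ[ℂ] H) +
    TensorProduct.map LinearMap.id (LinearMap.id - (P : H →ₗ[ℂ] H))

/-- The operator of a gate, for the oracle `U`, the projector `P` and the initial state `ψ₀`. -/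
def Gate.op (U : H ≃ₗᵢ[ℂ] H) (P : H →L[ℂ] H) (ψ₀ : H) :
    Gate → (Qubit ⊗[ℂ] H →ₗ[ℂ] Qubit ⊗[ℂ] H)
  | .query => TensorProduct.map LinearMap.id U.toLinearEquiv.toLinearMap
  | .queryAdj => TensorProduct.map LinearMap.id U.symm.toLinearEquiv.toLinearMap
  | .cnotProj => cnot P
  | .cnotInit => cnot (InnerProductSpace.rankOne ℂ ψ₀ ψ₀)
  | .ancilla V =>
      TensorProduct.map (Matrix.toEuclideanLin (V : Matrix (Fin 2) (Fin 2) ℂ)) LinearMap.id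

/-- The operator of a circuit. -/
def Circuit.op (U : H ≃ₗᵢ[ℂ] H) (P : H →L[ℂ] H) (ψ₀ : H) :
    Circuit → (Qubit ⊗[ℂ] H →ₗ[ℂ] Qubit ⊗[ℂ] H)
  | [] => LinearMap.id
  | g :: c => Circuit.op U P ψ₀ c ∘ₗ g.op U P ψ₀

end Semantics

end FPAA

end

/-!
Starting from `ψ₀`, the alternation of `U`, phase rotations about the range of `Π`, `U†`, and phase
rotations about `ψ₀` stays in a plane on either side, so that the amplitudes are a pair of
polynomials in the overlap `α`. Each controlled rotation consists of two controlled NOTs around a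
rotation of the ancilla, and it applies the opposite phase when the ancilla is in `|1⟩`. Hence the
amplitudes there are the complex conjugates, and Hadamard gates at both ends leave the real part
`Re A(α)` of the amplitude of `ψG` in the ancilla state `|0⟩`. By unitarity the squared error is
exactly `2 - 2 Re A(α)` (`norm_sub_hadamardConj_sq`). It remains to find a suitable polynomial.

Which polynomials occur as `Re A`: every odd real `P` of degree at most `d` with `|P| < 1` on
`[-1, 1]` (`exists_isQSP_re`). A sum-of-squares factorization
`1 - P² = R² + (1 - X²) S²` (`isNormForm_of_pos`) yields `A = P + i R` and `B = S`, a pair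
satisfying the unitarity relation. Such a pair is decomposed into single-query steps by cancelling
leading coefficients (`isQSP_of_unitarity`).

Which polynomial to take: the normalized antiderivative of a power of the Fejér kernel
`(sin Nθ / (N sin θ))²`, `x = sin θ`, with `N ≈ e / δ` (`exists_sign_approx`). With the exponent
`m ≈ w / 4`, where `w = W(2¹¹ / (π ε⁸))`, its degree is at most about `e w / δ`, its distance from `1`
on `[δ, 1]` is below `ε² / 2`, and `d ≥ e w / δ + 1` (`le_half_numQueries`). No expansion of the
error function, which the formula for `d` suggests, is involved.

The asymptotic bound on `d` follows from `W(x) ≤ 1 + log x` for `x ≥ 1` (`numQueries_le`).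
-/

namespace FPAA

open Polynomial

open scoped ComplexConjugate

/-! ### Polynomials of bounded degree and fixed parity -/

/-- The polynomial has degree at most `n` and the parity of `n`. The bound is an integer, so that
`DegParity (-1) A` makes sense; it says `A = 0`. -/
def DegParity {R : Type*} [Semiring R] (n : ℤ) (A : R[X]) : Prop :=
  ∀ j : ℕ, A.coeff j ≠ 0 → ∃ i : ℕ, (j : ℤ) + 2 * i = n

namespace DegParity

variable {R : Type*} [CommRing R] {m n : ℤ} {A B : R[X]}

theorem zero (n : ℤ) : DegParity n (0 : R[X]) := fun j hj => absurd (coeff_zero j) hj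

theorem C (a : R) : DegParity 0 (Polynomial.C a) := fun j hj => by
  rcases Nat.eq_zero_or_pos j with rfl | h
  · exact ⟨0, by simp⟩
  · exact absurd (coeff_C_of_ne_zero h.ne') hj

theorem X : DegParity 1 (X : R[X]) := fun j hj => by
  rw [coeff_X] at hj
  have : 1 = j := by by_contra h; simp [h] at hj
  exact ⟨0, by subst this; simp⟩

theorem add (hA : DegParity n A) (hB : DegParity n B) : DegParity n (A + B) := fun j hj => by
  by_cases h : A.coeff j = 0
  · exact hB j (by simpa [h] using hj)
  · exact hA j h

theorem neg (hA : DegParity n A) : DegParity n (-A) := fun j hj => hA j (by simpa using hj)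

theorem sub (hA : DegParity n A) (hB : DegParity n B) : DegParity n (A - B) := by
  rw [sub_eq_add_neg]; exact hA.add hB.neg

theorem mul (hA : DegParity m A) (hB : DegParity n B) : DegParity (m + n) (A * B) := fun j hj => by
  rw [coeff_mul] at hj
  obtain ⟨⟨p, q⟩, hpq, h⟩ := Finset.exists_ne_zero_of_sum_ne_zero hj
  obtain ⟨i, hi⟩ := hA p (left_ne_zero_of_mul h)
  obtain ⟨k, hk⟩ := hB q (right_ne_zero_of_mul h)
  refine ⟨i + k, ?_⟩
  rw [Finset.HasAntidiagonal.mem_antidiagonal] at hpq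
  simp only at hpq
  push_cast [← hpq]
  linarith

theorem mono (hA : DegParity m A) (k : ℕ) (h : m + 2 * k = n) : DegParity n A := fun j hj => by
  obtain ⟨i, hi⟩ := hA j hj
  exact ⟨i + k, by push_cast; linarith⟩

theorem cast (hA : DegParity m A) (h : m = n) : DegParity n A := h ▸ hA

theorem C_mul (a : R) (hA : DegParity n A) : DegParity n (Polynomial.C a * A) :=
  ((C a).mul hA).cast (zero_add n)

theorem X_mul (hA : DegParity n A) : DegParity (n + 1) (Polynomial.X * A) :=
  (X.mul hA).cast (add_comm 1 n)

theorem X_sq : DegParity 2 (Polynomial.X ^ 2 : R[X]) := by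
  rw [sq]
  exact X.mul X

theorem one_sub_X_sq : DegParity 2 (1 - Polynomial.X ^ 2 : R[X]) := by
  exact DegParity.sub ((C (1 : R)).mono (n := 2) 1 (by norm_num)) X_sq

theorem one_sub_X_sq_mul (hA : DegParity n A) :
    DegParity (n + 2) ((1 - Polynomial.X ^ 2) * A) :=
  (one_sub_X_sq.mul hA).cast (add_comm 2 n)

theorem map {S : Type*} [CommRing S] (f : R →+* S) (hA : DegParity n A) :
    DegParity n (A.map f) := fun j hj => hA j fun h => hj (by rw [coeff_map, h, map_zero])

theorem natDegree_le {n : ℕ} (hA : DegParity (n : ℤ) A) : A.natDegree ≤ n :=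
  natDegree_le_iff_coeff_eq_zero.2 fun j hj => by
    by_contra h
    obtain ⟨i, hi⟩ := hA j h
    omega

theorem of_coeff_eq_zero {n : ℕ} (hA : DegParity (n : ℤ) A) (h : A.coeff n = 0) :
    DegParity (n - 2 : ℤ) A := fun j hj => by
  obtain ⟨i, hi⟩ := hA j hj
  have : i ≠ 0 := by
    rintro rfl
    have : j = n := by simpa using hi
    exact hj (this ▸ h)
  exact ⟨i - 1, by omega⟩

theorem comp_X_sq {n : ℕ} (h : A.natDegree ≤ n) :
    DegParity (2 * n : ℤ) (A.comp (Polynomial.X ^ 2)) := fun j hj => by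
  rw [← expand_eq_comp_X_pow, coeff_expand two_pos] at hj
  split_ifs at hj with h2
  · obtain ⟨k, rfl⟩ := h2
    rw [Nat.mul_div_cancel_left _ two_pos] at hj
    have := le_natDegree_of_ne_zero hj
    exact ⟨n - k, by push_cast [Nat.cast_sub (this.trans h)]; ring⟩
  · exact absurd rfl hj

end DegParity

/-! ### Complementary polynomials -/

/-- The polynomial `G` is `|A + i s C|²` for the formal square root `s = √(1 - X²)`, with `A` and
`s C` of degree at most `n` and the parity of `n`. On `x = cos θ` the functions `A + i s C` are the
trigonometric polynomials with real coefficients, so this is a Fejér–Riesz factorization. -/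
def IsNormForm (n : ℕ) (G : ℝ[X]) : Prop :=
  ∃ A C : ℝ[X], DegParity (n : ℤ) A ∧ DegParity (n - 1 : ℤ) C ∧
    G = A ^ 2 + (1 - X ^ 2) * C ^ 2

namespace IsNormForm

variable {m n : ℕ} {G G' : ℝ[X]}

theorem mul (h : IsNormForm m G) (h' : IsNormForm n G') : IsNormForm (m + n) (G * G') := by
  obtain ⟨A, B, hA, hB, rfl⟩ := h
  obtain ⟨A', B', hA', hB', rfl⟩ := h'
  refine ⟨A * A' - (1 - X ^ 2) * (B * B'), A * B' + B * A', ?_, ?_, by ring⟩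
  · exact ((hA.mul hA').cast (by push_cast; ring)).sub
      ((hB.mul hB').one_sub_X_sq_mul.cast (by push_cast; ring))
  · exact ((hA.mul hB').cast (by push_cast; ring)).add
      ((hB.mul hA').cast (by push_cast; ring))

theorem const {a : ℝ} (ha : 0 ≤ a) : IsNormForm 0 (C a) :=
  ⟨C √a, 0, DegParity.C _, DegParity.zero _, by
    rw [← C_pow, Real.sq_sqrt ha]; simp⟩

theorem one_one : IsNormForm 1 1 :=
  ⟨X, 1, DegParity.X, (DegParity.C (1 : ℝ)).cast (by norm_num), by ring⟩

theorem mono (h : IsNormForm m G) (hmn : m ≤ n) : IsNormForm n G := by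
  induction n, hmn using Nat.le_induction with
  | base => exact h
  | succ k _ ih => simpa using ih.mul one_one

/-- Linear factors with their zero outside `[0, 1]`. -/
theorem linear {a b : ℝ} (h0 : 0 ≤ b) (h1 : 0 ≤ a + b) :
    IsNormForm 1 ((C a * X + C b).comp (X ^ 2)) := by
  refine ⟨C √(a + b) * X, C √b, DegParity.X.C_mul _, (DegParity.C _).cast (by norm_num), ?_⟩
  rw [mul_pow, ← C_pow, ← C_pow, Real.sq_sqrt h0, Real.sq_sqrt h1]
  simp
  ring

/-- Quadratic factors `|y - z|²`, `z = p + i q`. The form is `A = a y + v`, `C = c x`, where the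
values at `y = 0` and `y = 1` force `v² = |z|²` and `(a + v)² = |1 - z|²`. The signs are opposite so
that `a² - 1 = c²` is nonnegative, by the triangle inequality `|z| + |1 - z| ≥ 1`. -/
theorem quadratic {p q : ℝ} :
    IsNormForm 2 (((X - C p) ^ 2 + C (q ^ 2)).comp (X ^ 2)) := by
  set v := √(p ^ 2 + q ^ 2)
  set r := √((1 - p) ^ 2 + q ^ 2)
  have hv : v ^ 2 = p ^ 2 + q ^ 2 := Real.sq_sqrt (by positivity)
  have hr : r ^ 2 = (1 - p) ^ 2 + q ^ 2 := Real.sq_sqrt (by positivity)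
  have h1 : p ≤ v := Real.le_sqrt_of_sq_le (by nlinarith)
  have h2 : 1 - p ≤ r := Real.le_sqrt_of_sq_le (by nlinarith)
  have hc : 0 ≤ (r + v) ^ 2 - 1 := by nlinarith
  refine ⟨C (-(r + v)) * X ^ 2 + C v, C √((r + v) ^ 2 - 1) * X, ?_,
    (DegParity.X.C_mul _).cast (by norm_num), ?_⟩
  · exact (DegParity.X_sq.C_mul _).add ((DegParity.C v).mono 1 (by norm_num))
  · rw [mul_pow (C _) X, ← C_pow, Real.sq_sqrt hc]
    have e1 : C r ^ 2 = (1 - C p) ^ 2 + C q ^ 2 := by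
      rw [← C_pow, hr]; simp
    have e2 : C v ^ 2 = C p ^ 2 + C q ^ 2 := by
      rw [← C_pow, hv]; simp
    simp only [add_comp, sub_comp, pow_comp, X_comp, C_comp, C_neg, C_add, C_sub, C_pow, C_1]
    linear_combination (-X ^ 2) * e1 + (X ^ 2 - 1) * e2

theorem eval_nonneg (h : IsNormForm n G) {x : ℝ} (hx : x ^ 2 ≤ 1) : 0 ≤ G.eval x := by
  obtain ⟨A, B, -, -, rfl⟩ := h
  simp only [eval_add, eval_mul, eval_pow, eval_sub, eval_one, eval_X]
  have : 0 ≤ 1 - x ^ 2 := by linarith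
  positivity

end IsNormForm

/-- Completing the square in a quadratic polynomial without real zeros. -/
theorem exists_eq_mul_sq_add_sq {a b c : ℝ} (ha : a ≠ 0)
    (hroot : ∀ y : ℝ, a * y ^ 2 + b * y + c ≠ 0) :
    ∃ p q : ℝ, C a * X ^ 2 + C b * X + C c = C a * ((X - C p) ^ 2 + C (q ^ 2)) := by
  have hq : 0 ≤ c / a - (b / (2 * a)) ^ 2 := by
    by_contra hneg
    push Not at hneg
    set s := √((b / (2 * a)) ^ 2 - c / a)
    have hs : s ^ 2 = (b / (2 * a)) ^ 2 - c / a := Real.sq_sqrt (by linarith)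
    apply hroot (s - b / (2 * a))
    have : a * (s - b / (2 * a)) ^ 2 + b * (s - b / (2 * a)) + c
        = a * (s ^ 2 - ((b / (2 * a)) ^ 2 - c / a)) := by field_simp; ring
    rw [this, hs, sub_self, mul_zero]
  refine ⟨-(b / (2 * a)), √(c / a - (b / (2 * a)) ^ 2), Polynomial.funext fun x => ?_⟩
  rw [Real.sq_sqrt hq]
  simp only [eval_add, eval_mul, eval_pow, eval_sub, eval_C, eval_X]
  field_simp
  ring

/-- An irreducible real polynomial without zeros in `[0, 1]` is a norm form up to sign. -/
theorem isNormForm_of_irreducible {g : ℝ[X]} (hg : Irreducible g)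
    (h : ∀ y ∈ Set.Icc (0 : ℝ) 1, g.eval y ≠ 0) :
    IsNormForm g.natDegree (g.comp (X ^ 2)) ∨ IsNormForm g.natDegree ((-g).comp (X ^ 2)) := by
  have hd : g.natDegree ≤ 2 := natDegree_le_of_degree_le hg.degree_le_two
  have hd0 : 0 < g.natDegree := hg.natDegree_pos
  obtain h1 | h2 : g.natDegree = 1 ∨ g.natDegree = 2 := by omega
  · obtain ⟨a, b, hgab⟩ : ∃ a b, g = C a * X + C b := ⟨_, _, eq_X_add_C_of_natDegree_le_one h1.le⟩
    rw [h1]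
    subst hgab
    -- a linear polynomial with opposite signs at the ends has a zero in between
    have key : ¬ (b ≤ 0 ∧ 0 ≤ a + b) ∧ ¬ (0 ≤ b ∧ a + b ≤ 0) := by
      have hmem : ∀ y ∈ Set.Icc (0 : ℝ) 1, a * y + b ≠ 0 := by simpa using h
      have ha : a ≠ 0 := by
        rintro rfl
        simp at h1
      constructor
      · rintro ⟨hb, hab⟩
        have ha' : 0 < a := lt_of_le_of_ne (by linarith) ha.symm
        exact hmem (-b / a) ⟨div_nonneg (by linarith) ha'.le,
          (div_le_one ha').2 (by linarith)⟩ (by field_simp; ring)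
      · rintro ⟨hb, hab⟩
        have ha' : a < 0 := lt_of_le_of_ne (by linarith) ha
        exact hmem (-b / a) ⟨div_nonneg_of_nonpos (by linarith) ha'.le,
          (div_le_one_of_neg ha').2 (by linarith)⟩ (by field_simp; ring)
    rcases le_total 0 b with hb | hb
    · left
      refine IsNormForm.linear hb ?_
      by_contra hc
      exact key.2 ⟨hb, by linarith⟩
    · right
      have : -(C a * X + C b) = C (-a) * X + C (-b) := by simp; ring
      rw [this]
      refine IsNormForm.linear (by linarith) ?_
      by_contra hc
      exact key.1 ⟨hb, by linarith⟩
  · obtain ⟨a, b, c, hgabc⟩ : ∃ a b c, g = C a * X ^ 2 + C b * X + C c :=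
      ⟨_, _, _, eq_quadratic_of_degree_le_two hg.degree_le_two⟩
    have ha : a ≠ 0 := by
      rintro rfl
      have : g.natDegree ≤ 1 := by
        rw [hgabc]; simp only [C_0, zero_mul, zero_add]; exact natDegree_linear_le
      omega
    obtain ⟨p, q, hpq⟩ := exists_eq_mul_sq_add_sq ha fun y hy => by
      refine hg.not_isRoot_of_natDegree_ne_one (by omega) (x := y) ?_
      rw [hgabc, IsRoot]
      simpa using hy
    have hga := hgabc.trans hpq
    rw [h2, hga]
    rcases le_total 0 a with ha0 | ha0
    · left
      rw [mul_comp, C_comp]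
      simpa using (IsNormForm.const ha0).mul (IsNormForm.quadratic)
    · right
      rw [← neg_mul, ← C_neg, mul_comp, C_comp]
      simpa using (IsNormForm.const (neg_nonneg.2 ha0)).mul (IsNormForm.quadratic)

theorem isNormForm_or_neg {g : ℝ[X]} (h : ∀ y ∈ Set.Icc (0 : ℝ) 1, g.eval y ≠ 0) :
    IsNormForm g.natDegree (g.comp (X ^ 2)) ∨ IsNormForm g.natDegree ((-g).comp (X ^ 2)) := by
  induction g using WfDvdMonoid.induction_on_irreducible with
  | zero => exact absurd eval_zero (h 0 (by simp))
  | unit u hu =>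
    obtain ⟨a, -, rfl⟩ := Polynomial.isUnit_iff.1 hu
    rw [natDegree_C, C_comp, ← C_neg, C_comp]
    rcases le_total 0 a with ha | ha
    · exact .inl (.const ha)
    · exact .inr (.const (neg_nonneg.2 ha))
  | mul a i ha hi ih =>
    have hi' := isNormForm_of_irreducible hi fun y hy h0 => h y hy (by simp [h0])
    have ha' := ih fun y hy h0 => h y hy (by simp [h0])
    rw [natDegree_mul hi.ne_zero ha]
    rcases hi' with h1 | h1 <;> rcases ha' with h2 | h2
    · exact .inl (by simpa using h1.mul h2)
    · exact .inr (by simpa using h1.mul h2)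
    · exact .inr (by simpa using h1.mul h2)
    · exact .inl (by simpa using h1.mul h2)

/-- **Lukács' theorem** for polynomials that are positive on `[0, 1]`. -/
theorem isNormForm_of_pos {g : ℝ[X]} (h : ∀ y ∈ Set.Icc (0 : ℝ) 1, 0 < g.eval y) :
    IsNormForm g.natDegree (g.comp (X ^ 2)) := by
  refine (isNormForm_or_neg fun y hy => (h y hy).ne').resolve_right fun hn => ?_
  have h1 := hn.eval_nonneg (x := 0) (by norm_num)
  have h2 := h 0 (by simp)
  simp [eval_comp] at h1
  linarith

/-! ### Decomposition of a polynomial pair into single-query steps -/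

/-- The pairs `(A, B)` that `n` steps of quantum signal processing produce. In the invariant plane
of amplitude amplification, with coordinates `(a, b)` relative to an orthogonal (not normalized)
basis, a query acts as the involution `(a, b) ↦ (x a + (1 - x²) b, a - x b)` and a phase rotation
as `(a, b) ↦ (u a, u⁻¹ b)`, where `x` is the overlap and `u` is a phase. -/
inductive IsQSP : ℕ → ℂ[X] → ℂ[X] → Prop
  | zero (u : ℂ) (hu : ‖u‖ = 1) : IsQSP 0 (C u) 0
  | succ {n : ℕ} {A B : ℂ[X]} (u : ℂ) (hu : ‖u‖ = 1) (h : IsQSP n A B) :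
      IsQSP (n + 1) (C u * (X * A + (1 - X ^ 2) * B)) (C (conj u) * (A - X * B))

theorem conj_mul_self_of_norm_eq_one {u : ℂ} (hu : ‖u‖ = 1) : conj u * u = 1 := by
  rw [Complex.conj_mul', hu]; simp

/-- A phase that balances two complex numbers of equal modulus. -/
theorem exists_phase {p q : ℂ} (h : p * conj p = q * conj q) :
    ∃ u : ℂ, ‖u‖ = 1 ∧ conj u * p = u * q := by
  have hn : ‖p‖ = ‖q‖ := by
    rw [Complex.mul_conj', Complex.mul_conj'] at h
    have h' : ‖p‖ ^ 2 = ‖q‖ ^ 2 := by exact_mod_cast h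
    exact (sq_eq_sq₀ (norm_nonneg _) (norm_nonneg _)).1 h'
  by_cases hq : q = 0
  · have hp : p = 0 := by simpa [hq] using hn
    exact ⟨1, by simp, by simp [hp, hq]⟩
  · obtain ⟨u, hu⟩ := IsAlgClosed.exists_pow_nat_eq (p / q) two_pos
    have hu1 : ‖u‖ = 1 := by
      have : ‖u‖ ^ 2 = 1 := by
        rw [← norm_pow, hu, norm_div, hn, div_self (norm_ne_zero_iff.2 hq)]
      exact (pow_eq_one_iff_of_nonneg (norm_nonneg _) two_ne_zero).1 this
    have hp : p = u ^ 2 * q := by rw [hu]; field_simp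
    exact ⟨u, hu1, by
      rw [hp]; linear_combination u * q * conj_mul_self_of_norm_eq_one hu1⟩

theorem norm_leadingCoeff_eq {n : ℕ} {A B : ℂ[X]} (hA : A.natDegree ≤ n + 1)
    (hB : B.natDegree ≤ n)
    (h : A * A.map (starRingEnd ℂ) + (1 - X ^ 2) * (B * B.map (starRingEnd ℂ)) = 1) :
    A.coeff (n + 1) * conj (A.coeff (n + 1)) = B.coeff n * conj (B.coeff n) := by
  have hA' : (A.map (starRingEnd ℂ)).natDegree ≤ n + 1 := natDegree_map_le.trans hA
  have hB' : (B.map (starRingEnd ℂ)).natDegree ≤ n := natDegree_map_le.trans hB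
  have h1 := coeff_mul_add_eq_of_natDegree_le hA hA'
  have h2 := coeff_mul_add_eq_of_natDegree_le hB hB'
  have h3 : (B * B.map (starRingEnd ℂ)).coeff (n + n + 2) = 0 :=
    coeff_eq_zero_of_natDegree_lt <|
      (natDegree_mul_le.trans (add_le_add hB hB')).trans_lt (by omega)
  have h4 := congrArg (fun P => coeff P (n + n + 2)) h
  simp only [coeff_add, sub_mul, coeff_sub, one_mul, coeff_X_pow_mul, h2, h3, coeff_one,
    coeff_map] at h4
  rw [show n + n + 2 = n + 1 + (n + 1) by ring, h1, coeff_map] at h4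
  simp only [show n + 1 + (n + 1) ≠ 0 by omega, if_false] at h4
  linear_combination h4

/-- Quantum signal processing: every pair of polynomials of the right degrees and parities that
satisfies the unitarity relation is produced by some sequence of phases. Since the query step is an
involution, it can be undone; the phase is chosen so that undoing it cancels the leading
coefficients. -/
theorem isQSP_of_unitarity : ∀ (n : ℕ) {A B : ℂ[X]}, DegParity (n : ℤ) A →
    DegParity (n - 1 : ℤ) B →
    A * A.map (starRingEnd ℂ) + (1 - X ^ 2) * (B * B.map (starRingEnd ℂ)) = 1 → IsQSP n A B
  | 0, A, B, hA, hB, h => by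
    have hB0 : B = 0 := by
      ext j
      by_contra hj
      obtain ⟨i, hi⟩ := hB j hj
      push_cast at hi
      omega
    obtain ⟨a, ha⟩ : ∃ a, A = C a := ⟨_, eq_C_of_natDegree_le_zero hA.natDegree_le⟩
    subst ha hB0
    refine .zero a ?_
    have h1 : C (a * conj a) = (C 1 : ℂ[X]) := by simpa using h
    have h2 := C_injective h1
    rw [Complex.mul_conj'] at h2
    have h3 : ‖a‖ ^ 2 = 1 := by exact_mod_cast h2
    exact (pow_eq_one_iff_of_nonneg (norm_nonneg _) two_ne_zero).1 h3
  | n + 1, A, B, hA, hB, h => by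
    have hB' : DegParity (n : ℤ) B := hB.cast (by push_cast; ring)
    obtain ⟨u, hu, hpq⟩ := exists_phase
      (norm_leadingCoeff_eq hA.natDegree_le hB'.natDegree_le h)
    have huu := conj_mul_self_of_norm_eq_one hu
    have hCu : (C (conj u) * C u : ℂ[X]) = 1 := by rw [← C_mul, huu, C_1]
    have hBn : B.coeff (n + 2) = 0 :=
      coeff_eq_zero_of_natDegree_lt (hB'.natDegree_le.trans_lt (by omega))
    set A' := X * (C (conj u) * A) + (1 - X ^ 2) * (C u * B) with hA'
    set B' := C (conj u) * A - X * (C u * B) with hB'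
    have h1 : DegParity (n : ℤ) A' := by
      have : DegParity ((n + 2 : ℕ) : ℤ) A' :=
        ((hA.C_mul _).X_mul.cast (by push_cast; ring)).add
          ((hB.C_mul _).one_sub_X_sq_mul.cast (by push_cast; ring))
      refine (this.of_coeff_eq_zero ?_).cast (by push_cast; ring)
      simp only [hA', sub_mul, one_mul, coeff_add, coeff_sub, coeff_X_mul, coeff_C_mul,
        coeff_X_pow_mul, hBn]
      linear_combination hpq
    have h2 : DegParity (n - 1 : ℤ) B' := by
      have : DegParity ((n + 1 : ℕ) : ℤ) B' :=
        (hA.C_mul _).sub ((hB.C_mul _).X_mul.cast (by push_cast; ring))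
      refine (this.of_coeff_eq_zero ?_).cast (by push_cast; ring)
      simp only [hB', coeff_sub, coeff_X_mul, coeff_C_mul]
      linear_combination hpq
    have h3 : A' * A'.map (starRingEnd ℂ) + (1 - X ^ 2) * (B' * B'.map (starRingEnd ℂ)) = 1 := by
      simp only [hA', hB', Polynomial.map_add, Polynomial.map_sub, Polynomial.map_mul,
        Polynomial.map_pow, Polynomial.map_one, map_X, map_C, Complex.conj_conj]
      linear_combination h + (A * A.map (starRingEnd ℂ) +
        (1 - X ^ 2) * (B * B.map (starRingEnd ℂ))) * hCu
    have h4 := IsQSP.succ u hu (isQSP_of_unitarity n h1 h2 h3)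
    convert h4 using 1
    · rw [hA', hB']
      linear_combination (-A) * hCu
    · rw [hA', hB']
      linear_combination (-B) * hCu

/-- An odd real polynomial that is bounded by `1` on `[-1, 1]` is the real part of a polynomial
that quantum signal processing produces. -/
theorem exists_isQSP_re {r : ℕ} {p : ℝ[X]} (hp : p.natDegree ≤ r)
    (hlt : ∀ x ∈ Set.Icc (0 : ℝ) 1, |x * p.eval (x ^ 2)| < 1) :
    ∃ A B : ℂ[X], IsQSP (2 * r + 1) A B ∧
      ∀ x : ℝ, (A.eval (x : ℂ)).re = x * p.eval (x ^ 2) := by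
  set P : ℝ[X] := X * p.comp (X ^ 2) with hP
  have hPpar : DegParity ((2 * r + 1 : ℕ) : ℤ) P :=
    (DegParity.comp_X_sq hp).X_mul.cast (by push_cast; ring)
  have hg : IsNormForm (2 * r + 1) ((1 - X * p ^ 2).comp (X ^ 2)) := by
    refine (isNormForm_of_pos fun y hy => ?_).mono ?_
    · have h1 := hlt √y ⟨Real.sqrt_nonneg y, Real.sqrt_le_one.2 hy.2⟩
      rw [← sq_lt_one_iff_abs_lt_one, Real.sq_sqrt hy.1, mul_pow, Real.sq_sqrt hy.1] at h1
      simpa using h1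
    · refine (natDegree_sub_le _ _).trans (max_le (by simp) (natDegree_mul_le.trans ?_))
      have := natDegree_pow_le (p := p) (n := 2)
      rw [natDegree_X]
      omega
  obtain ⟨R, S, hR, hS, hRS⟩ := hg
  have hid : P ^ 2 + R ^ 2 + (1 - X ^ 2) * S ^ 2 = 1 := by
    simp only [sub_comp, one_comp, mul_comp, X_comp, pow_comp] at hRS
    rw [hP]
    linear_combination -hRS
  have hid' := congrArg (Polynomial.map Complex.ofRealHom) hid
  have hconj : ∀ Q : ℝ[X],
      (Q.map Complex.ofRealHom).map (starRingEnd ℂ) = Q.map Complex.ofRealHom := fun Q => by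
    rw [Polynomial.map_map]
    congr 1
    ext x
    simp
  have hI : (C Complex.I ^ 2 : ℂ[X]) = -1 := by
    rw [← C_pow, Complex.I_sq]; simp
  refine ⟨P.map Complex.ofRealHom + C Complex.I * R.map Complex.ofRealHom,
    S.map Complex.ofRealHom, isQSP_of_unitarity _ ?_ (hS.map _) ?_, fun x => ?_⟩
  · exact (hPpar.map _).add ((hR.map _).C_mul _)
  · simp only [Polynomial.map_add, Polynomial.map_sub, Polynomial.map_mul,
      Polynomial.map_pow, Polynomial.map_one, map_X, map_C, hconj, Complex.conj_I, C_neg] at hid' ⊢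
    linear_combination hid' - (R.map Complex.ofRealHom) ^ 2 * hI
  · have h1 : ∀ Q : ℝ[X], (Q.map Complex.ofRealHom).eval (x : ℂ) = ((Q.eval x : ℝ) : ℂ) := fun Q =>
      (Polynomial.eval_map_apply (f := Complex.ofRealHom) (p := Q) x)
    simp only [eval_add, eval_mul, eval_C, h1]
    simp [hP]

/-! ### Circuits that implement the steps -/

/-- The ancilla state `|1⟩`. -/
noncomputable def ket1 : Qubit := EuclideanSpace.single 1 1

/-- The ancilla rotation `diag(ū, u)`. -/
noncomputable def phaseGate (u : ℂ) (hu : ‖u‖ = 1) : Matrix.unitaryGroup (Fin 2) ℂ :=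
  ⟨!![conj u, 0; 0, u], by
    have h := conj_mul_self_of_norm_eq_one hu
    rw [Matrix.mem_unitaryGroup_iff]
    ext i j
    fin_cases i <;> fin_cases j <;>
      simp [Matrix.mul_apply, Fin.sum_univ_two, Matrix.star_apply, h, mul_comm u]⟩

/-- The Hadamard gate. -/
noncomputable def hadamard : Matrix.unitaryGroup (Fin 2) ℂ :=
  ⟨!![((√2)⁻¹ : ℝ), ((√2)⁻¹ : ℝ); ((√2)⁻¹ : ℝ), (-(√2)⁻¹ : ℝ)], by
    have h : ((√2 : ℝ) : ℂ)⁻¹ * ((√2 : ℝ) : ℂ)⁻¹ = 1 / 2 := by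
      rw [← mul_inv, ← Complex.ofReal_mul, Real.mul_self_sqrt zero_le_two]; simp
    rw [Matrix.mem_unitaryGroup_iff]
    ext i j
    fin_cases i <;> fin_cases j <;>
      simp [Matrix.mul_apply, Fin.sum_univ_two, Matrix.star_apply, h] <;> norm_num⟩

theorem pauliX_ket0 : pauliX ket0 = ket1 := by
  ext i; fin_cases i <;> simp [pauliX, ket0, ket1, Matrix.toLpLin_apply]

theorem pauliX_ket1 : pauliX ket1 = ket0 := by
  ext i; fin_cases i <;> simp [pauliX, ket0, ket1, Matrix.toLpLin_apply]

theorem phaseGate_ket0 (u : ℂ) (hu : ‖u‖ = 1) :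
    Matrix.toEuclideanLin (phaseGate u hu : Matrix (Fin 2) (Fin 2) ℂ) ket0 = conj u • ket0 := by
  ext i; fin_cases i <;> simp [phaseGate, ket0, Matrix.toLpLin_apply]

theorem phaseGate_ket1 (u : ℂ) (hu : ‖u‖ = 1) :
    Matrix.toEuclideanLin (phaseGate u hu : Matrix (Fin 2) (Fin 2) ℂ) ket1 = u • ket1 := by
  ext i; fin_cases i <;> simp [phaseGate, ket1, Matrix.toLpLin_apply]

theorem hadamard_ket0 : Matrix.toEuclideanLin (hadamard : Matrix (Fin 2) (Fin 2) ℂ) ket0 =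
    (((√2)⁻¹ : ℝ) : ℂ) • (ket0 + ket1) := by
  ext i; fin_cases i <;> simp [hadamard, ket0, ket1, Matrix.toLpLin_apply]

theorem hadamard_ket1 : Matrix.toEuclideanLin (hadamard : Matrix (Fin 2) (Fin 2) ℂ) ket1 =
    (((√2)⁻¹ : ℝ) : ℂ) • (ket0 - ket1) := by
  ext i; fin_cases i <;> simp [hadamard, ket0, ket1, Matrix.toLpLin_apply]

section Semantics

variable {H : Type*} [NormedAddCommGroup H] [InnerProductSpace ℂ H]

theorem Circuit.op_append (U : H ≃ₗᵢ[ℂ] H) (P : H →L[ℂ] H) (ψ₀ : H) (c c' : Circuit) :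
    Circuit.op U P ψ₀ (c ++ c') = Circuit.op U P ψ₀ c' ∘ₗ Circuit.op U P ψ₀ c := by
  induction c with
  | nil => rfl
  | cons g c ih => simp only [List.cons_append, Circuit.op, ih, LinearMap.comp_assoc]

variable {P : H →L[ℂ] H} {e f : H}

theorem cnot_tmul (w : Qubit) (he : P e = e) (hf : P f = 0) :
    cnot P (w ⊗ₜ (e + f)) = pauliX w ⊗ₜ e + w ⊗ₜ f := by
  simp [cnot, he, hf]

/-- Two controlled NOTs around a phase gate multiply the range of the projector by `u` and its
kernel by `ū`, when the ancilla is in the state `|0⟩`; for `|1⟩` the two phases change places. -/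
theorem phase_block (u : ℂ) (hu : ‖u‖ = 1) (he : P e = e) (hf : P f = 0) (a b : ℂ) :
    cnot P (TensorProduct.map (Matrix.toEuclideanLin
      (phaseGate u hu : Matrix (Fin 2) (Fin 2) ℂ)) LinearMap.id
        (cnot P (ket0 ⊗ₜ (a • e + b • f)))) = ket0 ⊗ₜ[ℂ] ((u * a) • e + (conj u * b) • f) ∧
    cnot P (TensorProduct.map (Matrix.toEuclideanLin
      (phaseGate u hu : Matrix (Fin 2) (Fin 2) ℂ)) LinearMap.id
        (cnot P (ket1 ⊗ₜ (a • e + b • f)))) = ket1 ⊗ₜ[ℂ] ((conj u * a) • e + (u * b) • f) := by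
  have hc : ∀ (w : Qubit) (a b : ℂ), cnot P (w ⊗ₜ (a • e + b • f)) =
      pauliX w ⊗ₜ (a • e) + w ⊗ₜ (b • f) := fun w a b =>
    cnot_tmul w (by rw [map_smul, he]) (by rw [map_smul, hf, smul_zero])
  have hc1 : ∀ (w : Qubit) (a : ℂ), cnot P (w ⊗ₜ (a • e)) = pauliX w ⊗ₜ (a • e) := fun w a => by
    simpa using hc w a 0
  have hc2 : ∀ (w : Qubit) (b : ℂ), cnot P (w ⊗ₜ (b • f)) = w ⊗ₜ (b • f) := fun w b => by
    simpa using hc w 0 b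
  constructor
  · rw [hc, pauliX_ket0, map_add, TensorProduct.map_tmul, TensorProduct.map_tmul, phaseGate_ket0,
      phaseGate_ket1, TensorProduct.smul_tmul, TensorProduct.smul_tmul, LinearMap.id_apply,
      LinearMap.id_apply, smul_smul, smul_smul, map_add, hc1, hc2, pauliX_ket1,
      ← TensorProduct.tmul_add]
  · rw [hc, pauliX_ket1, map_add, TensorProduct.map_tmul, TensorProduct.map_tmul, phaseGate_ket0,
      phaseGate_ket1, TensorProduct.smul_tmul, TensorProduct.smul_tmul, LinearMap.id_apply,
      LinearMap.id_apply, smul_smul, smul_smul, map_add, hc1, hc2, pauliX_ket0,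
      ← TensorProduct.tmul_add]

end Semantics

/-- The circuit turns the ancilla states `|0⟩` and `|1⟩`, with the system in the state `ψ₀`, into
the state with coordinates `A(α)`, `B(α)` and into its conjugate. After an even number of queries
the coordinates refer to `ψ₀` and the component of `U† ψG` orthogonal to it, after an odd number to
`ψG` and the component of `U ψ₀` orthogonal to it. -/
def Circuit.Implements.{u} (c : Circuit) (n : ℕ) (A B : ℂ[X]) : Prop :=
  ∀ (H : Type u) [NormedAddCommGroup H] [InnerProductSpace ℂ H]
    (U : H ≃ₗᵢ[ℂ] H) (P : H →L[ℂ] H) (ψ₀ ψG : H) (α : ℝ),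
    ‖ψ₀‖ = 1 → P ψG = ψG → P (U ψ₀) = (α : ℂ) • ψG → inner ℂ ψ₀ (U.symm ψG) = (α : ℂ) →
    let e := if Even n then ψ₀ else ψG
    let f := if Even n then U.symm ψG - (α : ℂ) • ψ₀ else U ψ₀ - (α : ℂ) • ψG
    Circuit.op U P ψ₀ c (ket0 ⊗ₜ[ℂ] ψ₀) =
      ket0 ⊗ₜ (A.eval (α : ℂ) • e + B.eval (α : ℂ) • f) ∧
    Circuit.op U P ψ₀ c (ket1 ⊗ₜ[ℂ] ψ₀) =
      ket1 ⊗ₜ (conj (A.eval (α : ℂ)) • e + conj (B.eval (α : ℂ)) • f)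

theorem IsQSP.exists_circuit.{u} {n : ℕ} {A B : ℂ[X]} (h : IsQSP n A B) :
    ∃ c : Circuit, c.countP Gate.isQuery = n ∧ c.countP Gate.isCnotProj = 2 * ((n + 1) / 2) ∧
      c.countP Gate.isCnotInit = 2 * (n / 2) ∧ c.countP Gate.isAncilla = n + 1 ∧
      Circuit.Implements.{u} c n A B := by
  induction h with
  | zero u hu =>
    refine ⟨[.ancilla (phaseGate (conj u) (by simpa using hu))], ?_, ?_, ?_, ?_, ?_⟩
    iterate 4 simp [List.countP_cons, Gate.isQuery, Gate.isCnotProj, Gate.isCnotInit,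
      Gate.isAncilla]
    intro H _ _ U P ψ₀ ψG α _ _ _ _
    simp [Circuit.op, Gate.op, phaseGate_ket0, phaseGate_ket1, TensorProduct.smul_tmul]
  | @succ n A B u hu _ ih =>
    obtain ⟨c, h1, h2, h3, h4, h5⟩ := ih
    rcases Nat.even_or_odd n with hn | hn
    · have hn' : ¬ Even (n + 1) := by simpa [Nat.even_add_one] using hn
      refine ⟨c ++ [.query, .cnotProj, .ancilla (phaseGate u hu), .cnotProj], ?_, ?_, ?_, ?_, ?_⟩
      iterate 4
        simp [List.countP_append, List.countP_cons, Gate.isQuery, Gate.isCnotProj, Gate.isCnotInit,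
          Gate.isAncilla, h1, h2, h3, h4]
        try (obtain ⟨k, rfl⟩ := hn; omega)
      intro H _ _ U P ψ₀ ψG α hψ hP hPU hin
      obtain ⟨h6, h7⟩ := h5 H U P ψ₀ ψG α hψ hP hPU hin
      simp only [hn, if_true] at h6 h7
      simp only [hn', if_false]
      have hf : P (U ψ₀ - (α : ℂ) • ψG) = 0 := by rw [map_sub, hPU, map_smul, hP, sub_self]
      have hU : ∀ a b : ℂ, U (a • ψ₀ + b • (U.symm ψG - (α : ℂ) • ψ₀)) =
          ((α * a + (1 - α ^ 2) * b) • ψG + (a - α * b) • (U ψ₀ - (α : ℂ) • ψG)) := fun a b => by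
        simp only [map_add, map_smul, map_sub, LinearIsometryEquiv.apply_symm_apply]
        module
      have hb := phase_block u hu hP hf
      rw [Circuit.op_append, LinearMap.comp_apply, LinearMap.comp_apply, h6, h7]
      simp only [Circuit.op, Gate.op, LinearMap.comp_apply, LinearMap.id_apply,
        TensorProduct.map_tmul]
      constructor
      · erw [hU, (hb _ _).1]
        simp
      · erw [hU, (hb _ _).2]
        simp
    · have hn' : Even (n + 1) := by simpa [Nat.even_add_one] using hn
      have hn'' : ¬ Even n := by simpa using hn
      refine ⟨c ++ [.queryAdj, .cnotInit, .ancilla (phaseGate u hu), .cnotInit], ?_, ?_, ?_, ?_, ?_⟩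
      iterate 4
        simp [List.countP_append, List.countP_cons, Gate.isQuery, Gate.isCnotProj, Gate.isCnotInit,
          Gate.isAncilla, h1, h2, h3, h4]
        try (obtain ⟨k, rfl⟩ := hn; omega)
      intro H _ _ U P ψ₀ ψG α hψ hP hPU hin
      obtain ⟨h6, h7⟩ := h5 H U P ψ₀ ψG α hψ hP hPU hin
      simp only [hn'', if_false] at h6 h7
      simp only [hn', if_true]
      have hψψ : inner ℂ ψ₀ ψ₀ = (1 : ℂ) := by rw [inner_self_eq_norm_sq_to_K, hψ]; simp
      have he : InnerProductSpace.rankOne ℂ ψ₀ ψ₀ ψ₀ = ψ₀ := by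
        rw [InnerProductSpace.rankOne_apply, hψψ, one_smul]
      have hf : InnerProductSpace.rankOne ℂ ψ₀ ψ₀ (U.symm ψG - (α : ℂ) • ψ₀) = 0 := by
        rw [InnerProductSpace.rankOne_apply, inner_sub_right, inner_smul_right, hin, hψψ]
        simp
      have hU : ∀ a b : ℂ, U.symm (a • ψG + b • (U ψ₀ - (α : ℂ) • ψG)) =
          ((α * a + (1 - α ^ 2) * b) • ψ₀ + (a - α * b) • (U.symm ψG - (α : ℂ) • ψ₀)) :=
        fun a b => by
          simp only [map_add, map_smul, map_sub, LinearIsometryEquiv.symm_apply_apply]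
          module
      have hb := phase_block u hu he hf
      rw [Circuit.op_append, LinearMap.comp_apply, LinearMap.comp_apply, h6, h7]
      simp only [Circuit.op, Gate.op, LinearMap.comp_apply, LinearMap.id_apply,
        TensorProduct.map_tmul]
      constructor
      · erw [hU, (hb _ _).1]
        simp
      · erw [hU, (hb _ _).2]
        simp

/-! ### The error of the output state -/

theorem IsQSP.norm_eval {n : ℕ} {A B : ℂ[X]} (h : IsQSP n A B) (x : ℝ) :
    ‖A.eval (x : ℂ)‖ ^ 2 + (1 - x ^ 2) * ‖B.eval (x : ℂ)‖ ^ 2 = 1 := by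
  induction h with
  | zero u hu => simp [hu]
  | @succ n A B u hu _ ih =>
    simp only [eval_mul, eval_C, norm_mul, hu, RCLike.norm_conj, one_mul, eval_add, eval_sub,
      eval_X, eval_pow, eval_one]
    generalize A.eval (x : ℂ) = a at *
    generalize B.eval (x : ℂ) = b at *
    have h1 : (x : ℂ) * a + (1 - (x : ℂ) ^ 2) * b = (x : ℂ) * a + ((1 - x ^ 2 : ℝ) : ℂ) * b := by
      push_cast; ring
    rw [h1]
    simp only [← Complex.normSq_eq_norm_sq, Complex.normSq_apply, Complex.add_re, Complex.add_im,
      Complex.re_ofReal_mul, Complex.im_ofReal_mul, Complex.sub_re, Complex.sub_im] at ih ⊢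
    linear_combination ih

section Semantics

variable {H : Type*} [NormedAddCommGroup H] [InnerProductSpace ℂ H]

theorem norm_ket_add_sq (x y : H) :
    ‖ket0 ⊗ₜ[ℂ] x + ket1 ⊗ₜ[ℂ] y‖ ^ 2 = ‖x‖ ^ 2 + ‖y‖ ^ 2 := by
  have h : inner ℂ (ket0 ⊗ₜ[ℂ] x) (ket1 ⊗ₜ[ℂ] y) = (0 : ℂ) := by
    simp [TensorProduct.inner_tmul, ket0, ket1, EuclideanSpace.inner_single_left]
  rw [norm_add_sq (𝕜 := ℂ), h]
  simp [TensorProduct.norm_tmul, ket0, ket1]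

theorem norm_smul_add_smul_sq {e f : H} {β : ℝ} (he : ‖e‖ = 1) (hf : ‖f‖ ^ 2 = β)
    (hef : inner ℂ e f = (0 : ℂ)) (a b : ℂ) :
    ‖a • e + b • f‖ ^ 2 = ‖a‖ ^ 2 + β * ‖b‖ ^ 2 := by
  rw [norm_add_sq (𝕜 := ℂ), inner_smul_left, inner_smul_right, hef, norm_smul, norm_smul, he,
    mul_pow, mul_pow, hf]
  simp
  ring

/-- Conjugating a circuit with Hadamard gates on the ancilla selects the real part of the amplitude
in the ancilla state `|0⟩`. -/
noncomputable def Circuit.hadamardConj (c : Circuit) : Circuit :=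
  .ancilla hadamard :: (c ++ [.ancilla hadamard])

theorem Circuit.op_hadamardConj (U : H ≃ₗᵢ[ℂ] H) (P : H →L[ℂ] H) (ψ₀ : H) (c : Circuit) {v w : H}
    (h0 : Circuit.op U P ψ₀ c (ket0 ⊗ₜ[ℂ] ψ₀) = ket0 ⊗ₜ v)
    (h1 : Circuit.op U P ψ₀ c (ket1 ⊗ₜ[ℂ] ψ₀) = ket1 ⊗ₜ w) :
    Circuit.op U P ψ₀ c.hadamardConj (ket0 ⊗ₜ[ℂ] ψ₀) =
      ket0 ⊗ₜ ((1 / 2 : ℂ) • (v + w)) + ket1 ⊗ₜ ((1 / 2 : ℂ) • (v - w)) := by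
  have hs : (((√2)⁻¹ : ℝ) : ℂ) * (((√2)⁻¹ : ℝ) : ℂ) = 1 / 2 := by
    rw [← Complex.ofReal_mul, ← mul_inv, Real.mul_self_sqrt zero_le_two]; simp
  simp only [Circuit.hadamardConj, Circuit.op, Circuit.op_append, LinearMap.comp_apply, Gate.op,
    TensorProduct.map_tmul, hadamard_ket0, LinearMap.id_apply]
  rw [← TensorProduct.smul_tmul', TensorProduct.add_tmul, map_smul, map_add, h0, h1, map_smul,
    map_add, TensorProduct.map_tmul, TensorProduct.map_tmul, hadamard_ket0, hadamard_ket1,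
    ← TensorProduct.smul_tmul', ← TensorProduct.smul_tmul', ← smul_add, smul_smul, hs,
    LinearMap.id_apply, LinearMap.id_apply, TensorProduct.add_tmul, TensorProduct.sub_tmul,
    TensorProduct.tmul_smul, TensorProduct.tmul_smul, TensorProduct.tmul_add,
    TensorProduct.tmul_sub]
  module

theorem overlap_le_one [CompleteSpace H] (U : H ≃ₗᵢ[ℂ] H) {P : H →L[ℂ] H} {ψ₀ ψG : H} {α : ℝ}
    (hP : IsStarProjection P) (h0 : ‖ψ₀‖ = 1) (hG : ‖ψG‖ = 1)
    (h : P (U ψ₀) = (α : ℂ) • ψG) : |α| ≤ 1 := by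
  have h1 := P.le_of_opNorm_le hP.norm_le (U ψ₀)
  rwa [h, norm_smul, hG, U.norm_map, h0, mul_one, mul_one, Complex.norm_real] at h1

/-- The squared distance of the output state from the target is `2 - 2 Re A(α)`. -/
theorem norm_sub_hadamardConj_sq.{u} {H : Type u} [NormedAddCommGroup H] [InnerProductSpace ℂ H]
    [CompleteSpace H] {c : Circuit} {n : ℕ} {A B : ℂ[X]}
    (hc : Circuit.Implements.{u} c n A B) (hAB : IsQSP n A B) (hn : ¬ Even n)
    (U : H ≃ₗᵢ[ℂ] H) {P : H →L[ℂ] H} {ψ₀ ψG : H} {α : ℝ}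
    (hP : IsStarProjection P) (h0 : ‖ψ₀‖ = 1) (hG : ‖ψG‖ = 1) (hα : α ≠ 0)
    (h : P (U ψ₀) = (α : ℂ) • ψG) :
    ‖ket0 ⊗ₜ[ℂ] ψG - Circuit.op U P ψ₀ c.hadamardConj (ket0 ⊗ₜ[ℂ] ψ₀)‖ ^ 2 =
      2 - 2 * (A.eval (α : ℂ)).re := by
  have hα' : (α : ℂ) ≠ 0 := Complex.ofReal_ne_zero.2 hα
  have hPG : P ψG = ψG := by
    have h1 : P (P (U ψ₀)) = P (U ψ₀) := congrArg (fun T => T (U ψ₀)) hP.isIdempotentElem.eq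
    rw [h, map_smul] at h1
    exact smul_right_injective _ hα' h1
  have hsa : ContinuousLinearMap.adjoint P = P := hP.isSelfAdjoint
  have hGU : inner ℂ ψG (U ψ₀) = (α : ℂ) := by
    rw [← hPG, ← ContinuousLinearMap.adjoint_inner_right, hsa, h, inner_smul_right,
      inner_self_eq_norm_sq_to_K, hG]
    simp
  have hin : inner ℂ ψ₀ (U.symm ψG) = (α : ℂ) := by
    rw [← U.inner_map_map, U.apply_symm_apply, ← inner_conj_symm, hGU, Complex.conj_ofReal]
  obtain ⟨h2, h3⟩ := hc H U P ψ₀ ψG α h0 hPG h hin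
  simp only [hn, if_false] at h2 h3
  set f := U ψ₀ - (α : ℂ) • ψG with hf
  have hGf : inner ℂ ψG f = (0 : ℂ) := by
    rw [hf, inner_sub_right, inner_smul_right, hGU, inner_self_eq_norm_sq_to_K, hG]
    simp
  have hff : ‖f‖ ^ 2 = 1 - α ^ 2 := by
    have h4 := norm_add_sq (𝕜 := ℂ) ((α : ℂ) • ψG) f
    rw [inner_smul_left, hGf, hf, add_sub_cancel, U.norm_map, h0, norm_smul, hG,
      Complex.norm_real, ← hf] at h4
    simp at h4
    linarith
  have hN := hAB.norm_eval α
  rw [Circuit.op_hadamardConj U P ψ₀ c h2 h3]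
  generalize A.eval (α : ℂ) = a at *
  generalize B.eval (α : ℂ) = b at *
  have e1 : ψG - (1 / 2 : ℂ) • (a • ψG + b • f + (conj a • ψG + conj b • f)) =
      (1 - (1 / 2) * (a + conj a)) • ψG + (-(1 / 2) * (b + conj b)) • f := by module
  have e2 : -((1 / 2 : ℂ) • (a • ψG + b • f - (conj a • ψG + conj b • f))) =
      (-(1 / 2) * (a - conj a)) • ψG + (-(1 / 2) * (b - conj b)) • f := by module
  have e3 : ∀ x y : H, ket0 ⊗ₜ[ℂ] ψG - (ket0 ⊗ₜ[ℂ] x + ket1 ⊗ₜ[ℂ] y) =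
      ket0 ⊗ₜ[ℂ] (ψG - x) + ket1 ⊗ₜ[ℂ] (-y) := fun x y => by
    rw [TensorProduct.tmul_sub, TensorProduct.tmul_neg]; abel
  rw [e3, norm_ket_add_sq, e1, e2, norm_smul_add_smul_sq hG hff hGf,
    norm_smul_add_smul_sq hG hff hGf]
  have e4 : ∀ z : ℂ, 1 - (1 / 2) * (z + conj z) = ((1 - z.re : ℝ) : ℂ) := fun z => by
    rw [Complex.add_conj]; push_cast; ring
  have e5 : ∀ z : ℂ, -(1 / 2) * (z + conj z) = ((-z.re : ℝ) : ℂ) := fun z => by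
    rw [Complex.add_conj]; push_cast; ring
  have e6 : ∀ z : ℂ, -(1 / 2) * (z - conj z) = ((-z.im : ℝ) : ℂ) * Complex.I := fun z => by
    rw [Complex.sub_conj]; push_cast; ring
  rw [e4, e5, e6, e6, norm_mul, norm_mul, Complex.norm_I, mul_one, mul_one]
  simp only [Complex.norm_real, Real.norm_eq_abs, sq_abs]
  rw [← Complex.normSq_eq_norm_sq, ← Complex.normSq_eq_norm_sq, Complex.normSq_apply,
    Complex.normSq_apply] at hN
  linear_combination hN

end Semantics

/-! ### A polynomial approximation of the sign function -/

/-- The Fejér polynomials: `fejerPoly N` has degree `N - 1`, and its value at `sin² θ` is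
`(sin Nθ / sin θ)²`. -/
noncomputable def fejerPoly : ℕ → ℝ[X]
  | 0 => 0
  | 1 => 1
  | N + 2 => 2 * (1 - 2 * X) * fejerPoly (N + 1) - fejerPoly N + 2

theorem natDegree_fejerPoly : ∀ N : ℕ, (fejerPoly (N + 1)).natDegree ≤ N
  | 0 => by simp [fejerPoly]
  | 1 => by
    simp only [fejerPoly, sub_zero]
    compute_degree
  | N + 2 => by
    have h1 := natDegree_fejerPoly (N + 1)
    have h2 := natDegree_fejerPoly N
    rw [fejerPoly]
    have h3 : (2 * (1 - 2 * X) : ℝ[X]).natDegree ≤ 1 := by compute_degree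
    have h4 := natDegree_mul_le (p := (2 * (1 - 2 * X) : ℝ[X])) (q := fejerPoly (N + 1 + 1))
    refine (natDegree_add_le _ _).trans (max_le ((natDegree_sub_le _ _).trans (max_le ?_ ?_)) ?_)
    · omega
    · omega
    · simp

theorem eval_fejerPoly_add_two (N : ℕ) (y : ℝ) : (fejerPoly (N + 2)).eval y =
    2 * (1 - 2 * y) * (fejerPoly (N + 1)).eval y - (fejerPoly N).eval y + 2 := by
  simp [fejerPoly]

theorem fejerPoly_sin (θ : ℝ) : ∀ N : ℕ,
    Real.sin θ ^ 2 * (fejerPoly N).eval (Real.sin θ ^ 2) = Real.sin (N * θ) ^ 2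
  | 0 => by simp [fejerPoly]
  | 1 => by simp [fejerPoly]
  | N + 2 => by
    have h1 := fejerPoly_sin θ (N + 1)
    have h2 := fejerPoly_sin θ N
    rw [eval_fejerPoly_add_two]
    push_cast at h1 ⊢
    have e1 : Real.sin ((N + 1) * θ) = Real.sin (N * θ) * Real.cos θ +
        Real.cos (N * θ) * Real.sin θ := by rw [← Real.sin_add]; ring_nf
    have e2 : Real.sin ((N + 2) * θ) = 2 * Real.sin ((N + 1) * θ) * Real.cos θ -
        Real.sin (N * θ) := by
      have a1 : Real.sin ((N + 2) * θ) = Real.sin ((N + 1) * θ + θ) := by ring_nf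
      have a2 : Real.sin (N * θ) = Real.sin ((N + 1) * θ - θ) := by ring_nf
      rw [a1, a2, Real.sin_add, Real.sin_sub]; ring
    have e3 := Real.sin_sq_add_cos_sq θ
    have e4 := Real.sin_sq_add_cos_sq (N * θ)
    rw [e2]
    rw [e1] at h1 ⊢
    generalize Real.sin (N * θ) = s at *
    generalize Real.cos (N * θ) = c at *
    generalize Real.cos θ = C at *
    generalize Real.sin θ = S at *
    linear_combination 2 * (1 - 2 * S ^ 2) * h1 - h2 +
      (2 * s ^ 2 - 4 * (s * C + c * S) ^ 2) * e3 - 2 * S ^ 2 * e4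

theorem fejerPoly_mul_le {N : ℕ} {x : ℝ} (hx : x ∈ Set.Icc (0 : ℝ) 1) :
    x ^ 2 * (fejerPoly N).eval (x ^ 2) ∈ Set.Icc (0 : ℝ) 1 := by
  have h := fejerPoly_sin (Real.arcsin x) N
  rw [Real.sin_arcsin (by linarith [hx.1]) hx.2] at h
  rw [h]
  exact ⟨sq_nonneg _, Real.sin_sq_le_one _⟩

theorem fejerPoly_zero : ∀ N : ℕ, (fejerPoly N).eval 0 = N ^ 2
  | 0 => by simp [fejerPoly]
  | 1 => by simp [fejerPoly]
  | N + 2 => by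
    rw [eval_fejerPoly_add_two, fejerPoly_zero (N + 1), fejerPoly_zero N]
    push_cast
    ring

theorem abs_sin_nat_mul_le (N : ℕ) (θ : ℝ) : |Real.sin (N * θ)| ≤ N * |Real.sin θ| := by
  induction N with
  | zero => simp
  | succ N ih =>
    push_cast
    rw [add_one_mul, Real.sin_add]
    refine (abs_add_le _ _).trans ?_
    rw [abs_mul, abs_mul]
    have h1 := mul_le_mul_of_nonneg_left (Real.abs_cos_le_one θ) (abs_nonneg (Real.sin (N * θ)))
    have h2 := mul_le_mul_of_nonneg_right (Real.abs_cos_le_one (N * θ)) (abs_nonneg (Real.sin θ))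
    linarith

theorem fejerPoly_le {N : ℕ} {x : ℝ} (hx : x ∈ Set.Icc (0 : ℝ) 1) :
    (fejerPoly N).eval (x ^ 2) ≤ N ^ 2 := by
  rcases hx.1.eq_or_lt with rfl | h0
  · simp [fejerPoly_zero]
  · have h := fejerPoly_sin (Real.arcsin x) N
    have h1 := abs_sin_nat_mul_le N (Real.arcsin x)
    rw [Real.sin_arcsin (by linarith [hx.1]) hx.2] at h h1
    have h2 := pow_le_pow_left₀ (abs_nonneg _) h1 2
    rw [sq_abs, ← h, mul_pow, sq_abs, mul_comm] at h2
    exact le_of_mul_le_mul_right h2 (by positivity)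

theorem fejerPoly_nonneg {N : ℕ} {x : ℝ} (hx : x ∈ Set.Icc (0 : ℝ) 1) :
    0 ≤ (fejerPoly N).eval (x ^ 2) := by
  rcases hx.1.eq_or_lt with rfl | h0
  · simp [fejerPoly_zero]
  · exact nonneg_of_mul_nonneg_right (fejerPoly_mul_le hx).1 (by positivity)

/-- The second-order lower bound at the peak. It comes from summing the second differences
`F (N + 2) - 2 F (N + 1) + F N = 2 - 4 x² F (N + 1) ≥ 2 - 4 x² (N + 1)²` twice. -/
theorem le_fejerPoly (N : ℕ) {x : ℝ} (hx : x ∈ Set.Icc (0 : ℝ) 1) :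
    (N : ℝ) ^ 2 * (1 - N ^ 2 / 3 * x ^ 2) ≤ (fejerPoly N).eval (x ^ 2) := by
  have key : ∀ N : ℕ, (N : ℝ) ^ 2 - x ^ 2 * (N ^ 2 * (N ^ 2 - 1) / 3) ≤
        (fejerPoly N).eval (x ^ 2) ∧
      2 * (N : ℝ) + 1 - 4 * x ^ 2 * (N * (N + 1) * (2 * N + 1) / 6) ≤
        (fejerPoly (N + 1)).eval (x ^ 2) - (fejerPoly N).eval (x ^ 2) := by
    intro N
    induction N with
    | zero => simp [fejerPoly]
    | succ N ih =>
      obtain ⟨h1, h2⟩ := ih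
      constructor
      · push_cast
        nlinarith
      · rw [eval_fejerPoly_add_two]
        have h3 := mul_le_mul_of_nonneg_left (fejerPoly_le (N := N + 1) hx) (sq_nonneg x)
        push_cast at h3 ⊢
        nlinarith
  have h := (key N).1
  have : 0 ≤ x ^ 2 * (N : ℝ) ^ 2 / 3 := by positivity
  linarith

/-- An even polynomial has an odd antiderivative of the same degree plus one. -/
theorem exists_odd_antideriv (k : ℝ[X]) : ∃ p : ℝ[X], p.natDegree ≤ k.natDegree ∧
    ∀ x : ℝ, HasDerivAt (fun x => x * p.eval (x ^ 2)) (k.eval (x ^ 2)) x := by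
  refine ⟨∑ i ∈ Finset.range (k.natDegree + 1), C (k.coeff i / (2 * i + 1)) * X ^ i,
    natDegree_sum_le_of_forall_le _ _ fun i hi => (natDegree_C_mul_X_pow_le _ _).trans
      (Nat.lt_succ_iff.1 (Finset.mem_range.1 hi)), fun x => ?_⟩
  have h1 : ∀ x : ℝ, x * (∑ i ∈ Finset.range (k.natDegree + 1),
      C (k.coeff i / (2 * i + 1)) * X ^ i : ℝ[X]).eval (x ^ 2) =
      ∑ i ∈ Finset.range (k.natDegree + 1), k.coeff i / (2 * i + 1) * x ^ (2 * i + 1) := by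
    intro x
    rw [eval_finsetSum, Finset.mul_sum]
    refine Finset.sum_congr rfl fun i _ => ?_
    simp only [eval_mul, eval_C, eval_pow, eval_X]
    ring
  simp only [h1]
  rw [eval_eq_sum_range]
  refine HasDerivAt.fun_sum fun i _ => ?_
  refine ((hasDerivAt_pow (2 * i + 1) x).const_mul (k.coeff i / (2 * i + 1))).congr_deriv ?_
  have : (2 * (i : ℝ) + 1) ≠ 0 := by positivity
  push_cast
  rw [← pow_mul]
  field_simp

/-- The normalized antiderivative of the Jackson-type kernel
`((sin Nθ) / (N sin θ)) ^ (2 (j + 1))` approximates the sign function. The kernel is at most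
`(N x) ^ (-2 (j + 1))` away from the peak at `x = 0`, and of height `1` and width about `1 / N` at
the peak, so the ratio of the tail mass beyond `δ` to the total mass depends on `N δ` only. -/
theorem exists_sign_approx {N : ℕ} (j : ℕ) {δ : ℝ} (hδ : 0 < δ) (hδ1 : δ ≤ 1)
    (hN : Real.exp 1 ≤ N * δ) :
    ∃ p : ℝ[X], p.natDegree ≤ (j + 1) * (N - 1) ∧ ∀ x ∈ Set.Icc (0 : ℝ) 1,
      x * p.eval (x ^ 2) ∈ Set.Icc (0 : ℝ) 1 ∧
      (δ ≤ x → 1 - 8 / 9 * Real.exp (-(2 * j + 1)) ≤ x * p.eval (x ^ 2)) := by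
  have hN2 : (2 : ℝ) ≤ N := by
    have := Real.add_one_le_exp (1 : ℝ)
    nlinarith [Nat.cast_nonneg (α := ℝ) N]
  have hN0 : (0 : ℝ) < N := by linarith
  set k : ℝ[X] := (C (1 / (N : ℝ) ^ 2) * fejerPoly N) ^ (j + 1) with hk
  obtain ⟨q, hqd, hq⟩ := exists_odd_antideriv k
  set κ : ℝ → ℝ := fun x => k.eval (x ^ 2) with hκ
  set Q : ℝ → ℝ := fun x => x * q.eval (x ^ 2) with hQ
  have hQκ : ∀ x, HasDerivAt Q (κ x) x := hq
  have hQc : Continuous Q := continuous_iff_continuousAt.2 fun x => (hQκ x).continuousAt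
  have hκeq : ∀ x, κ x = ((fejerPoly N).eval (x ^ 2) / N ^ 2) ^ (j + 1) := fun x => by
    simp only [hκ, hk, eval_pow, eval_mul, eval_C]
    congr 1
    ring
  have hκ0 : ∀ x ∈ Set.Icc (0 : ℝ) 1, 0 ≤ κ x := fun x hx => by
    rw [hκeq]
    exact pow_nonneg (div_nonneg (fejerPoly_nonneg hx) (by positivity)) _
  have hmono : MonotoneOn Q (Set.Icc 0 1) :=
    monotoneOn_of_deriv_nonneg (convex_Icc 0 1) hQc.continuousOn
      (fun x _ => (hQκ x).differentiableAt.differentiableWithinAt) fun x hx => by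
        rw [(hQκ x).deriv]
        exact hκ0 x (interior_subset hx)
  have hQ0 : Q 0 = 0 := by simp [hQ]
  -- the mass of the peak, by Bernoulli's inequality on `[0, h]`
  set h : ℝ := 3 / (2 * ((j + 1 : ℕ) : ℝ) * N) with hh
  have hj0 : (0 : ℝ) < ((j + 1 : ℕ) : ℝ) := by positivity
  have hj1 : (1 : ℝ) ≤ ((j + 1 : ℕ) : ℝ) := by simp
  have hh0 : 0 < h := by positivity
  have hh1 : h ≤ 1 := by
    rw [hh, div_le_one (by positivity)]
    nlinarith
  have hNh : N * h ≤ 3 / 2 := by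
    rw [hh]
    field_simp
    linarith
  have hmass : 9 / (8 * ((j + 1 : ℕ) : ℝ) * N) ≤ Q 1 := by
    set R : ℝ → ℝ := fun x => x - ((j + 1 : ℕ) : ℝ) * N ^ 2 / 9 * x ^ 3 with hR
    have hRd : ∀ x, HasDerivAt R (1 - ((j + 1 : ℕ) : ℝ) * N ^ 2 / 3 * x ^ 2) x := fun x => by
      refine ((hasDerivAt_id x).sub ((hasDerivAt_pow 3 x).const_mul
        (((j + 1 : ℕ) : ℝ) * N ^ 2 / 9))).congr_deriv ?_
      push_cast
      ring
    have hm : MonotoneOn (Q - R) (Set.Icc 0 h) := by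
      refine monotoneOn_of_deriv_nonneg (convex_Icc 0 h) ?_ ?_ fun x hx => ?_
      · exact fun x _ => ((hQκ x).sub (hRd x)).continuousAt.continuousWithinAt
      · exact fun x _ => ((hQκ x).sub (hRd x)).differentiableAt.differentiableWithinAt
      · rw [((hQκ x).sub (hRd x)).deriv, sub_nonneg, hκeq]
        have hx' := interior_subset hx
        have hx1 : x ∈ Set.Icc (0 : ℝ) 1 := ⟨hx'.1, hx'.2.trans hh1⟩
        have h1 : 1 - N ^ 2 / 3 * x ^ 2 ≤ (fejerPoly N).eval (x ^ 2) / (N : ℝ) ^ 2 := by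
          rw [le_div_iff₀ (by positivity), mul_comm]
          exact le_fejerPoly N hx1
        have h2 : (N * x) ^ 2 ≤ (3 / 2 : ℝ) ^ 2 :=
          pow_le_pow_left₀ (mul_nonneg hN0.le hx'.1)
            ((mul_le_mul_of_nonneg_left hx'.2 hN0.le).trans hNh) 2
        have h3 := one_add_mul_le_pow (a := -((N : ℝ) ^ 2 / 3 * x ^ 2)) (by nlinarith) (j + 1)
        refine (le_of_eq ?_).trans (h3.trans (pow_le_pow_left₀ ?_ ?_ _))
        · ring
        · nlinarith
        · linarith
    have h1 := hm ⟨le_rfl, hh0.le⟩ ⟨hh0.le, le_rfl⟩ hh0.le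
    have h2 := hmono ⟨hh0.le, hh1⟩ ⟨zero_le_one, le_rfl⟩ hh1
    have h3 : R h = h * (1 - 1 / (4 * ((j + 1 : ℕ) : ℝ))) := by
      rw [hR, hh]
      field_simp
      ring
    have h4 : h * (3 / 4) ≤ R h := by
      rw [h3]
      refine mul_le_mul_of_nonneg_left ?_ hh0.le
      have : 1 / (4 * ((j + 1 : ℕ) : ℝ)) ≤ 1 / 4 :=
        one_div_le_one_div_of_le (by norm_num) (by linarith)
      linarith
    have h5 : 9 / (8 * ((j + 1 : ℕ) : ℝ) * N) = h * (3 / 4) := by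
      rw [hh]
      field_simp
      norm_num
    have hR0 : R 0 = 0 := by simp [hR]
    simp only [Pi.sub_apply, hQ0, hR0] at h1
    linarith
  have hQ1 : 0 < Q 1 := lt_of_lt_of_le (by positivity) hmass
  -- the mass of the tail, by comparison with an antiderivative of `(N x) ^ (-2 (j + 1))`
  have htail : Q 1 - Q δ ≤ 1 / (N * (2 * j + 1)) * Real.exp (-(2 * j + 1)) := by
    set c : ℝ := 1 / ((N : ℝ) ^ (2 * j + 2) * (2 * j + 1)) with hc
    have hc0 : 0 < c := by positivity
    set T : ℝ → ℝ := fun x => c * (x ^ (2 * j + 1))⁻¹ with hT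
    have hTd : ∀ x, 0 < x → HasDerivAt T (-(1 / (N * x) ^ (2 * j + 2))) x := fun x hx => by
      refine (((hasDerivAt_pow (2 * j + 1) x).fun_inv (by positivity)).const_mul c).congr_deriv ?_
      have : (2 * (j : ℝ) + 1) ≠ 0 := by positivity
      rw [hc, mul_pow, Nat.add_sub_cancel]
      push_cast
      field_simp
      ring
    have hm : AntitoneOn (Q + T) (Set.Icc δ 1) := by
      have hd : ∀ x ∈ Set.Icc δ 1, HasDerivAt (Q + T) (κ x + -(1 / (N * x) ^ (2 * j + 2))) x :=
        fun x hx => (hQκ x).add (hTd x (hδ.trans_le hx.1))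
      refine antitoneOn_of_deriv_nonpos (convex_Icc δ 1)
        (fun x hx => (hd x hx).continuousAt.continuousWithinAt)
        (fun x hx => (hd x (interior_subset hx)).differentiableAt.differentiableWithinAt)
        fun x hx => ?_
      have hx' := interior_subset hx
      have hx0 : 0 < x := hδ.trans_le hx'.1
      rw [(hd x hx').deriv, hκeq, ← sub_eq_add_neg, sub_nonpos,
        show 2 * j + 2 = 2 * (j + 1) by ring, pow_mul, ← one_div_pow]
      refine pow_le_pow_left₀ (div_nonneg (fejerPoly_nonneg ⟨hx0.le, hx'.2⟩) (by positivity)) ?_ _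
      rw [div_le_div_iff₀ (by positivity) (by positivity), mul_pow]
      have := (fejerPoly_mul_le (N := N) ⟨hx0.le, hx'.2⟩).2
      nlinarith [sq_nonneg (N : ℝ)]
    have h1 := hm ⟨le_rfl, hδ1⟩ ⟨hδ1, le_rfl⟩ hδ1
    simp only [Pi.add_apply] at h1
    have hT1 : 0 ≤ T 1 := by simp only [hT]; positivity
    have hTδ : T δ = 1 / (N * (2 * j + 1)) * ((N * δ) ^ (2 * j + 1))⁻¹ := by
      simp only [hT, hc]
      field_simp
      ring
    have h2 : ((N * δ) ^ (2 * j + 1))⁻¹ ≤ Real.exp (-(2 * j + 1)) := by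
      rw [Real.exp_neg]
      refine inv_anti₀ (Real.exp_pos _) ?_
      have := pow_le_pow_left₀ (Real.exp_pos 1).le hN (2 * j + 1)
      rw [← Real.exp_nat_mul, mul_one] at this
      exact_mod_cast this
    have h3 : T δ ≤ 1 / (N * (2 * j + 1)) * Real.exp (-(2 * j + 1)) := by
      rw [hTδ]
      exact mul_le_mul_of_nonneg_left h2 (by positivity)
    linarith
  refine ⟨C (Q 1)⁻¹ * q, ?_, fun x hx => ?_⟩
  · refine (natDegree_C_mul_le _ _).trans (hqd.trans (natDegree_pow_le.trans ?_))
    refine Nat.mul_le_mul_left _ ((natDegree_C_mul_le _ _).trans ?_)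
    obtain ⟨M, rfl⟩ : ∃ M, N = M + 1 :=
      Nat.exists_eq_succ_of_ne_zero (by rintro rfl; simp at hN0)
    exact natDegree_fejerPoly M
  · have he : x * (C (Q 1)⁻¹ * q).eval (x ^ 2) = Q x / Q 1 := by
      simp only [eval_mul, eval_C, hQ]
      ring
    rw [he]
    have h0 := hmono ⟨le_rfl, zero_le_one⟩ hx hx.1
    have h1 := hmono hx ⟨zero_le_one, le_rfl⟩ hx.2
    rw [hQ0] at h0
    refine ⟨⟨div_nonneg h0 hQ1.le, (div_le_one hQ1).2 h1⟩, fun hδx => ?_⟩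
    have h2 := hmono ⟨hδ.le, hδ1⟩ hx hδx
    rw [le_div_iff₀ hQ1]
    have h3 : 1 / (N * (2 * j + 1)) * Real.exp (-(2 * j + 1)) ≤
        8 / 9 * Real.exp (-(2 * j + 1)) * (9 / (8 * ((j + 1 : ℕ) : ℝ) * N)) := by
      have : 8 / 9 * Real.exp (-(2 * j + 1)) * (9 / (8 * ((j + 1 : ℕ) : ℝ) * N)) =
          1 / (N * ((j + 1 : ℕ) : ℝ)) * Real.exp (-(2 * j + 1)) := by
        field_simp
      rw [this]
      refine mul_le_mul_of_nonneg_right (one_div_le_one_div_of_le (by positivity) ?_)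
        (Real.exp_pos _).le
      refine mul_le_mul_of_nonneg_left ?_ hN0.le
      push_cast
      linarith [Nat.cast_nonneg (α := ℝ) j]
    have h4 : 8 / 9 * Real.exp (-(2 * j + 1)) * (9 / (8 * ((j + 1 : ℕ) : ℝ) * N)) ≤
        8 / 9 * Real.exp (-(2 * j + 1)) * Q 1 :=
      mul_le_mul_of_nonneg_left hmass (by positivity)
    linarith

/-! ### Bounds for the number of queries -/

theorem lambertW_pos {x : ℝ} (hx : 0 < x) : 0 < lambertW x := by
  have h := (lambertW_spec hx.le).2
  exact pos_of_mul_pos_left (h ▸ hx) (Real.exp_pos _).le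

theorem lt_lambertW {a x : ℝ} (ha : 0 ≤ a) (hx : a * Real.exp a < x) : a < lambertW x := by
  have hx0 : 0 < x := lt_of_le_of_lt (mul_nonneg ha (Real.exp_pos a).le) hx
  by_contra h
  push Not at h
  have h1 := (lambertW_spec hx0.le).2
  have h2 := mul_le_mul h (Real.exp_le_exp.2 h) (Real.exp_pos _).le ha
  linarith

theorem lambertW_le {a x : ℝ} (ha : 1 ≤ a) (hx : 0 < x) (hxa : x ≤ a) :
    lambertW x ≤ 1 + Real.log a := by
  have h1 := (lambertW_spec hx.le).2
  have h0 := Real.log_nonneg ha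
  by_contra h
  push Not at h
  have h2 : Real.exp (lambertW x) ≤ a := by
    nlinarith [Real.exp_pos (lambertW x)]
  have h3 := (Real.le_log_iff_exp_le (by linarith)).2 h2
  linarith

variable {δ ε : ℝ}

theorem kParam_pos (hδ : 0 < δ) (hε : 0 < ε) : 0 < kParam δ ε := by
  have := lambertW_pos (x := 2 ^ 11 / (Real.pi * ε ^ 8)) (by positivity)
  unfold kParam
  positivity

theorem kParam_sq (hε : 0 < ε) :
    kParam δ ε ^ 2 = lambertW (2 ^ 11 / (Real.pi * ε ^ 8)) / (2 * δ ^ 2) := by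
  have := lambertW_pos (x := 2 ^ 11 / (Real.pi * ε ^ 8)) (by positivity)
  rw [kParam, mul_pow, Real.sq_sqrt (by positivity)]
  ring

theorem le_tParam : Real.exp 1 ^ 2 * kParam δ ε ^ 2 / 2 ≤ tParam δ ε :=
  (le_max_left _ _).trans (Nat.le_ceil _)

theorem tParam_pos (hδ : 0 < δ) (hε : 0 < ε) : (0 : ℝ) < tParam δ ε := by
  have := kParam_pos hδ hε
  exact lt_of_lt_of_le (by positivity) le_tParam

/-- The product `t W(c / t)` is increasing in `t`, so it can be bounded below by its value at
`t = e² k² / 2`, where `W(c / t) ≥ w`. -/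
theorem le_half_numQueries (hδ : 0 < δ) (hε : 0 < ε) :
    Real.exp 1 / δ * (lambertW (2 ^ 11 / (Real.pi * ε ^ 8)) / 2) ≤
      √(tParam δ ε * lambertW (2 ^ 16 * kParam δ ε ^ 2 / (Real.pi * tParam δ ε * ε ^ 8))) := by
  have ht := tParam_pos hδ hε
  have hk := kParam_pos hδ hε
  have hk2 := kParam_sq (δ := δ) hε
  have hle := le_tParam (δ := δ) (ε := ε)
  set w := lambertW (2 ^ 11 / (Real.pi * ε ^ 8)) with hw
  set t : ℝ := (tParam δ ε : ℝ)
  set k := kParam δ ε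
  have hw0 : 0 < w := lambertW_pos (by positivity)
  have hws : w * Real.exp w = 2 ^ 11 / (Real.pi * ε ^ 8) := (lambertW_spec (by positivity)).2
  set v := lambertW (2 ^ 16 * k ^ 2 / (Real.pi * t * ε ^ 8)) with hv
  have hvs : v * Real.exp v = 2 ^ 16 * k ^ 2 / (Real.pi * t * ε ^ 8) :=
    (lambertW_spec (by positivity)).2
  have hv0 : 0 < v := lambertW_pos (by positivity)
  refine Real.le_sqrt_of_sq_le ?_
  have h1 : (Real.exp 1 / δ * (w / 2)) ^ 2 = Real.exp 1 ^ 2 * k ^ 2 / 2 * w := by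
    rw [hk2]
    field_simp
  rw [h1]
  rcases le_or_gt w v with hwv | hwv
  · exact mul_le_mul hle hwv hw0.le ht.le
  · have h2 : t * v * Real.exp v = 32 * k ^ 2 * (w * Real.exp w) := by
      rw [mul_assoc, hvs, hws]
      field_simp
      norm_num
    have h3 : Real.exp v ≤ Real.exp w := Real.exp_le_exp.2 hwv.le
    have h4 : 32 * k ^ 2 * w ≤ t * v := by
      have h5 : 32 * k ^ 2 * w * Real.exp w ≤ t * v * Real.exp w := by
        calc _ = t * v * Real.exp v := by rw [h2]; ring
          _ ≤ _ := mul_le_mul_of_nonneg_left h3 (by positivity)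
      exact le_of_mul_le_mul_right h5 (Real.exp_pos w)
    refine le_trans ?_ h4
    have he : Real.exp 1 ^ 2 / 2 ≤ 32 := by
      nlinarith [Real.exp_one_lt_d9, Real.exp_pos 1]
    nlinarith [mul_le_mul_of_nonneg_right he (by positivity : 0 ≤ k ^ 2 * w)]

/-- The exponent of the kernel, chosen as `m ≈ w / 4`. -/
theorem exists_kernel_exponent (hε : 0 < ε) (hε2 : ε ^ 2 < 2) :
    ∃ j : ℕ, 2 * ((j : ℝ) + 1) ≤ lambertW (2 ^ 11 / (Real.pi * ε ^ 8)) ∧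
      Real.exp (-(2 * j + 1)) ≤ ε ^ 2 / 2 := by
  have he := Real.exp_one_lt_d9
  have hpi := Real.pi_lt_d2
  have hpi0 := Real.pi_pos
  have hε8 : ε ^ 8 < 16 := by
    have : ε ^ 8 = (ε ^ 2) ^ 4 := by ring
    rw [this]
    calc (ε ^ 2) ^ 4 < 2 ^ 4 := pow_lt_pow_left₀ hε2 (by positivity) (by norm_num)
      _ = 16 := by norm_num
  have hw2 : 2 < lambertW (2 ^ 11 / (Real.pi * ε ^ 8)) := by
    refine lt_lambertW zero_le_two ?_
    have h2 : Real.exp 2 = Real.exp 1 ^ 2 := by rw [← Real.exp_nat_mul]; norm_num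
    have h3 : Real.exp 2 < 8 := by rw [h2]; nlinarith [Real.exp_pos 1]
    rw [lt_div_iff₀ (by positivity)]
    have h4 : Real.pi * ε ^ 8 < 3.15 * 16 :=
      mul_lt_mul hpi hε8.le (by positivity) (by norm_num)
    have := mul_lt_mul'' h3 h4 (Real.exp_pos _).le (by positivity)
    linarith
  have hws : lambertW (2 ^ 11 / (Real.pi * ε ^ 8)) *
      Real.exp (lambertW (2 ^ 11 / (Real.pi * ε ^ 8))) = 2 ^ 11 / (Real.pi * ε ^ 8) :=
    (lambertW_spec (by positivity)).2
  set w := lambertW (2 ^ 11 / (Real.pi * ε ^ 8))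
  obtain ⟨j, hj⟩ : ∃ j, ⌈w / 4⌉₊ = j + 1 :=
    Nat.exists_eq_succ_of_ne_zero (Nat.ceil_pos.2 (by linarith)).ne'
  have hj1 : w / 4 ≤ (j : ℝ) + 1 := by
    have := Nat.le_ceil (w / 4)
    rw [hj] at this
    exact_mod_cast this
  have hj2 : (j : ℝ) + 1 < w / 4 + 1 := by
    have := Nat.ceil_lt_add_one (a := w / 4) (by linarith)
    rw [hj] at this
    exact_mod_cast this
  refine ⟨j, ?_, ?_⟩
  · rcases le_or_gt w 4 with h4 | h4
    · have : j = 0 := by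
        have h5 : (j : ℝ) < 1 := by linarith
        exact_mod_cast Nat.lt_one_iff.1 (by exact_mod_cast h5)
      subst this
      push_cast
      linarith
    · linarith
  · refine (pow_le_pow_iff_left₀ (Real.exp_pos _).le (by positivity) four_ne_zero).1 ?_
    have h1 : Real.exp (-(2 * j + 1)) ^ 4 ≤ Real.exp (4 - 2 * w) := by
      rw [← Real.exp_nat_mul]
      refine Real.exp_le_exp.2 ?_
      push_cast
      linarith
    refine h1.trans ?_
    -- `w exp (-w) ≤ exp (-1)`
    have h2 : w ≤ Real.exp (w - 1) := by linarith [Real.add_one_le_exp (w - 1)]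
    have h3 : ε ^ 8 = 2 ^ 11 / (Real.pi * (w * Real.exp w)) := by
      rw [hws]
      field_simp
    have h4 : (ε ^ 2 / 2) ^ 4 = ε ^ 8 / 16 := by ring
    rw [h4, h3, div_div, le_div_iff₀ (by positivity)]
    have h5 : Real.exp (4 - 2 * w) * (Real.exp (w - 1) * Real.exp w) = Real.exp 1 ^ 3 := by
      rw [← Real.exp_add, ← Real.exp_add, ← Real.exp_nat_mul]
      congr 1
      push_cast
      ring
    have h6 : Real.exp 1 ^ 3 ≤ 27 := by
      calc Real.exp 1 ^ 3 ≤ 3 ^ 3 := pow_le_pow_left₀ (Real.exp_pos 1).le (by linarith) 3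
        _ = 27 := by norm_num
    calc Real.exp (4 - 2 * w) * (Real.pi * (w * Real.exp w) * 16)
        = 16 * Real.pi * (Real.exp (4 - 2 * w) * (w * Real.exp w)) := by ring
      _ ≤ 16 * Real.pi * (Real.exp (4 - 2 * w) * (Real.exp (w - 1) * Real.exp w)) := by gcongr
      _ ≤ 16 * 3.15 * 27 := by
        rw [h5]
        gcongr
      _ ≤ 2 ^ 11 := by norm_num

theorem numQueries_le {ε₀ : ℝ} (h0 : 0 < ε₀) (h1 : ε₀ < 1) :
    ∃ C : ℝ, ∀ δ ε : ℝ, 0 < δ → δ ≤ 1 → 0 < ε → ε ≤ ε₀ →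
      (numQueries δ ε : ℝ) ≤ C * (1 / δ * Real.log (1 / ε)) := by
  set l := Real.log (1 / ε₀) with hl
  have hl0 : 0 < l := Real.log_pos (one_lt_one_div h0 h1)
  set K := 18 / l + 8 with hK
  have hK0 : 0 < K := by positivity
  refine ⟨7 * K, fun δ ε hδ hδ1 hε hεε => ?_⟩
  set Λ := Real.log (1 / ε) with hΛ
  have hlΛ : l ≤ Λ := Real.log_le_log (by positivity) (one_div_le_one_div_of_le hε hεε)
  have hΛK : 18 + 8 * Λ ≤ K * Λ := by
    have : 18 ≤ 18 / l * Λ := by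
      rw [div_mul_eq_mul_div, le_div_iff₀ hl0]
      linarith
    rw [hK]
    linarith
  have hΛ0 : 0 < Λ := hl0.trans_le hlΛ
  set S := K * Λ / δ ^ 2 with hS
  have hδ2 : δ ^ 2 ≤ 1 := pow_le_one₀ hδ.le hδ1
  have hKS : K * Λ ≤ S := le_div_self (by positivity) (by positivity) hδ2
  have hlogε : Real.log ε = -Λ := by rw [hΛ, one_div, Real.log_inv, neg_neg]
  have hlog2 : Real.log 2 ≤ 1 := by linarith [Real.log_two_lt_d9]
  have hε1 : ε ≤ 1 := hεε.trans h1.le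
  have hW : ∀ x : ℝ, 0 < x → x ≤ 2 ^ 17 / ε ^ 8 → lambertW x ≤ K * Λ := fun x hx hxa => by
    have ha : (1 : ℝ) ≤ 2 ^ 17 / ε ^ 8 := by
      rw [le_div_iff₀ (by positivity), one_mul]
      exact (pow_le_one₀ hε.le hε1).trans (by norm_num)
    refine (lambertW_le ha hx hxa).trans (le_trans ?_ hΛK)
    rw [Real.log_div (by positivity) (by positivity), Real.log_pow, Real.log_pow, hlogε]
    push_cast
    linarith
  have hk := kParam_pos hδ hε
  have ht := tParam_pos hδ hε
  have hpi := Real.pi_gt_three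
  have he1 : 2 ≤ Real.exp 1 := by linarith [Real.add_one_le_exp (1 : ℝ)]
  have he2 := Real.exp_one_lt_d9
  have hk2 : kParam δ ε ^ 2 ≤ S / 2 := by
    rw [kParam_sq hε, hS, div_div, mul_comm (δ ^ 2)]
    refine div_le_div_of_nonneg_right (hW _ (by positivity) ?_) (by positivity)
    rw [← div_div]
    refine div_le_div_of_nonneg_right ?_ (by positivity)
    exact (div_le_self (by positivity) (by linarith)).trans (by norm_num)
  have htS : (tParam δ ε : ℝ) ≤ 3 * S := by
    have h2 : max (Real.exp 1 ^ 2 * kParam δ ε ^ 2 / 2)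
        (Real.log (2 ^ 8 * kParam δ ε / (√Real.pi * ε ^ 4))) ≤ 2 * S + 10 := by
      refine max_le ?_ ?_
      · have : Real.exp 1 ^ 2 ≤ 8 := by nlinarith
        nlinarith [mul_le_mul_of_nonneg_right this (sq_nonneg (kParam δ ε))]
      · have hsp : 1 ≤ √Real.pi := Real.one_le_sqrt.2 (by linarith)
        rw [Real.log_div (by positivity) (by positivity), Real.log_mul (by positivity) hk.ne',
          Real.log_mul (by positivity) (by positivity), Real.log_pow, Real.log_pow, hlogε]
        have h3 := Real.log_nonneg hsp
        have h4 := Real.log_le_sub_one_of_pos hk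
        push_cast
        nlinarith [sq_nonneg (kParam δ ε - 1)]
    have h3 := Nat.ceil_lt_add_one (a := max (Real.exp 1 ^ 2 * kParam δ ε ^ 2 / 2)
        (Real.log (2 ^ 8 * kParam δ ε / (√Real.pi * ε ^ 4))))
        (le_max_of_le_left (by positivity))
    have h4 : (tParam δ ε : ℝ) < _ := h3
    linarith
  have hv : lambertW (2 ^ 16 * kParam δ ε ^ 2 / (Real.pi * tParam δ ε * ε ^ 8)) ≤ K * Λ := by
    refine hW _ (by positivity) ?_
    rw [← div_div]
    refine div_le_div_of_nonneg_right ?_ (by positivity)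
    rw [div_le_iff₀ (by positivity)]
    have h2 : kParam δ ε ^ 2 ≤ tParam δ ε := by
      refine le_trans ?_ le_tParam
      have : 2 ≤ Real.exp 1 ^ 2 := by nlinarith
      nlinarith [mul_le_mul_of_nonneg_right this (sq_nonneg (kParam δ ε))]
    nlinarith
  have hroot : √(tParam δ ε *
      lambertW (2 ^ 16 * kParam δ ε ^ 2 / (Real.pi * tParam δ ε * ε ^ 8))) ≤
        2 * (K * Λ / δ) := by
    refine Real.sqrt_le_iff.2 ⟨by positivity, ?_⟩
    refine (mul_le_mul_of_nonneg_left hv ht.le).trans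
      ((mul_le_mul_of_nonneg_right htS (by positivity)).trans ?_)
    have : 3 * S * (K * Λ) = 3 * (K * Λ / δ) ^ 2 := by
      rw [hS]; field_simp
    rw [this, mul_pow]
    nlinarith [sq_nonneg (K * Λ / δ)]
  have hKδ : K * Λ ≤ K * Λ / δ := le_div_self (by positivity) hδ hδ1
  have hceil := Nat.ceil_lt_add_one (Real.sqrt_nonneg (tParam δ ε *
      lambertW (2 ^ 16 * kParam δ ε ^ 2 / (Real.pi * tParam δ ε * ε ^ 8))))
  have hfin : 7 * K * (1 / δ * Λ) = 7 * (K * Λ / δ) := by ring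
  rw [hfin, numQueries]
  push_cast
  linarith

/-! ### The amplification circuit -/

/-- The amplification polynomial `x p(x²)`: its degree is within the query budget, it is bounded by
`1`, and it is `ε² / 2`-close to `1` at overlaps of at least `δ`. The sign approximation is scaled down
slightly, since the factorization of the complement requires the bound `1` to be strict. -/
theorem exists_amplification_poly {δ ε : ℝ} (hδ : 0 < δ) (hε : 0 < ε) :
    ∃ p : ℝ[X], 2 * p.natDegree + 1 ≤ numQueries δ ε ∧
      (∀ x ∈ Set.Icc (0 : ℝ) 1, |x * p.eval (x ^ 2)| < 1) ∧
      ∀ x ∈ Set.Icc δ 1, 2 - 2 * (x * p.eval (x ^ 2)) ≤ ε ^ 2 := by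
  by_cases hcase : δ ≤ 1 ∧ ε ^ 2 < 2
  · obtain ⟨hδ1, hε2⟩ := hcase
    obtain ⟨j, hj, hje⟩ := exists_kernel_exponent hε hε2
    set N := ⌈Real.exp 1 / δ⌉₊ with hN
    have hNδ : Real.exp 1 ≤ N * δ := (div_le_iff₀ hδ).1 (Nat.le_ceil _)
    obtain ⟨p, hpd, hp⟩ := exists_sign_approx j hδ hδ1 hNδ
    set η := ε ^ 2 / 2 with hη
    have hη0 : 0 < η := by positivity
    have hη1 : η < 1 := by rw [hη]; linarith
    refine ⟨C (1 - η / 10) * p, ?_, fun x hx => ?_, fun x hx => ?_⟩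
    · have h1 : (C (1 - η / 10) * p).natDegree ≤ (j + 1) * (N - 1) :=
        (natDegree_C_mul_le _ _).trans hpd
      have h2 := le_half_numQueries hδ hε
      have h3 : (((j + 1) * (N - 1) : ℕ) : ℝ) ≤ √(tParam δ ε *
          lambertW (2 ^ 16 * kParam δ ε ^ 2 / (Real.pi * tParam δ ε * ε ^ 8))) := by
        refine le_trans ?_ h2
        have hNpos : 1 ≤ N := Nat.ceil_pos.2 (by positivity)
        have h4 : (N : ℝ) < Real.exp 1 / δ + 1 := Nat.ceil_lt_add_one (by positivity)
        rw [Nat.cast_mul, Nat.cast_sub hNpos, mul_comm]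
        push_cast
        exact mul_le_mul (by linarith) (by linarith) (by positivity) (by positivity)
      have h5 := Nat.cast_le.1 (h3.trans (Nat.le_ceil _))
      unfold numQueries
      omega
    · obtain ⟨h1, -⟩ := hp x hx
      have he : x * (C (1 - η / 10) * p).eval (x ^ 2) =
          (1 - η / 10) * (x * p.eval (x ^ 2)) := by
        simp only [eval_mul, eval_C]; ring
      rw [he, abs_lt]
      constructor <;> nlinarith [h1.1, h1.2]
    · obtain ⟨-, h2⟩ := hp x ⟨hδ.le.trans hx.1, hx.2⟩
      have h3 := h2 hx.1
      have he : x * (C (1 - η / 10) * p).eval (x ^ 2) =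
          (1 - η / 10) * (x * p.eval (x ^ 2)) := by
        simp only [eval_mul, eval_C]; ring
      have h4 : 1 - 8 / 9 * η ≤ x * p.eval (x ^ 2) := by linarith
      have h5 := mul_le_mul_of_nonneg_left h4 (by linarith : 0 ≤ 1 - η / 10)
      rw [he]
      have h6 : ε ^ 2 = 2 * η := by rw [hη]; ring
      rw [h6]
      nlinarith
  · -- there is no overlap `α ≥ δ`, or amplitudes `≥ 0` suffice
    refine ⟨C (1 / 2), by simp [numQueries], fun x hx => ?_, fun x hx => ?_⟩
    · rw [eval_C, abs_lt]
      constructor <;> linarith [hx.1, hx.2]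
    · have h2 : 2 ≤ ε ^ 2 := by
        by_contra h
        exact hcase ⟨hx.1.trans hx.2, not_le.1 h⟩
      rw [eval_C]
      linarith [hx.1]

theorem exists_amplification_circuit.{u} {δ ε : ℝ} (hδ : 0 < δ) (hε : 0 < ε) :
    ∃ c : Circuit,
      c.countP Gate.isQuery = numQueries δ ε ∧
      c.countP Gate.isCnotProj = numQueries δ ε + 1 ∧
      c.countP Gate.isCnotInit = numQueries δ ε - 1 ∧
      c.countP Gate.isAncilla ≤ 4 * numQueries δ ε ∧
      ∀ (H : Type u) [NormedAddCommGroup H] [InnerProductSpace ℂ H] [CompleteSpace H]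
        (U : H ≃ₗᵢ[ℂ] H) (P : H →L[ℂ] H) (ψ₀ ψG : H) (α : ℝ),
        IsStarProjection P → ‖ψ₀‖ = 1 → ‖ψG‖ = 1 → δ ≤ α →
        P (U ψ₀) = (α : ℂ) • ψG →
        ‖ket0 ⊗ₜ[ℂ] ψG - Circuit.op U P ψ₀ c (ket0 ⊗ₜ[ℂ] ψ₀)‖ ≤ ε := by
  obtain ⟨p, hpd, hlt, hp⟩ := exists_amplification_poly hδ hε
  obtain ⟨r, hr⟩ : ∃ r, numQueries δ ε = 2 * r + 1 := ⟨_, rfl⟩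
  rw [hr] at hpd ⊢
  obtain ⟨A, B, hAB, hA⟩ := exists_isQSP_re (r := r) (by omega) hlt
  obtain ⟨c, h1, h2, h3, h4, hc⟩ := hAB.exists_circuit
  have hodd : ¬ Even (2 * r + 1) := by simp
  refine ⟨c.hadamardConj, ?_, ?_, ?_, ?_, fun H _ _ _ U P ψ₀ ψG α hP h0 hG hα h => ?_⟩
  · simp [Circuit.hadamardConj, List.countP_append, Gate.isQuery, h1]
  · simp only [Circuit.hadamardConj, List.countP_append, List.countP_cons, Gate.isCnotProj, h2,
      List.countP_nil]
    simp
    omega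
  · simp only [Circuit.hadamardConj, List.countP_append, List.countP_cons, Gate.isCnotInit, h3,
      List.countP_nil]
    simp
    omega
  · simp only [Circuit.hadamardConj, List.countP_append, List.countP_cons, Gate.isAncilla, h4,
      List.countP_nil]
    simp
    omega
  · have hα0 : 0 < α := hδ.trans_le hα
    have hα1 : α ≤ 1 := (le_abs_self α).trans (overlap_le_one U hP h0 hG h)
    have h5 := norm_sub_hadamardConj_sq hc hAB hodd U hP h0 hG hα0.ne' h
    rw [hA] at h5
    refine (pow_le_pow_iff_left₀ (norm_nonneg _) hε.le two_ne_zero).1 ?_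
    rw [h5]
    exact hp α ⟨hα, hα1⟩

end FPAA

theorem theorem5 :
    (∃ C : ℕ, ∀ δ ε : ℝ, 0 < δ → 0 < ε →
      ∃ c : FPAA.Circuit,
        c.countP FPAA.Gate.isQuery = FPAA.numQueries δ ε ∧
        c.countP FPAA.Gate.isCnotProj = FPAA.numQueries δ ε + 1 ∧
        c.countP FPAA.Gate.isCnotInit = FPAA.numQueries δ ε - 1 ∧
        c.countP FPAA.Gate.isAncilla ≤ C * FPAA.numQueries δ ε ∧
        ∀ (H : Type*) [NormedAddCommGroup H] [InnerProductSpace ℂ H] [CompleteSpace H]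
          (U : H ≃ₗᵢ[ℂ] H) (P : H →L[ℂ] H) (ψ₀ ψG : H) (α : ℝ),
          IsStarProjection P → ‖ψ₀‖ = 1 → ‖ψG‖ = 1 → δ ≤ α →
          P (U ψ₀) = (α : ℂ) • ψG →
          ‖FPAA.ket0 ⊗ₜ[ℂ] ψG - FPAA.Circuit.op U P ψ₀ c (FPAA.ket0 ⊗ₜ[ℂ] ψ₀)‖ ≤ ε) ∧
    (∀ ε₀ : ℝ, 0 < ε₀ → ε₀ < 1 →
      ∃ C : ℝ, ∀ δ ε : ℝ, 0 < δ → δ ≤ 1 → 0 < ε → ε ≤ ε₀ →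
        (FPAA.numQueries δ ε : ℝ) ≤ C * (1 / δ * Real.log (1 / ε))) := by
  exact ⟨⟨4, fun _ _ hδ hε => FPAA.exists_amplification_circuit hδ hε⟩,
    fun _ h0 h1 => FPAA.numQueries_le h0 h1⟩
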